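/- Let $d\ge 2$, $c>0$, $\gamma\in(0,1)$, and define $q^*\in(2,\infty)$ by $$\frac1{q^*}=\frac12-\frac1{\frac{d-1}{\gamma}+1}.$$ Then there is a constant $C_{PS}=C_{PS}(d,c,\gamma)>0$ with the following property. Let $M\ge 1$, $\delta\in(0,1)$, and let $f:\left[-\frac{\delta}{2M},\frac{\delta}{2M}\right]^{d-1}\to\left[\frac{\delta}{4},\delta\right)$ satisfy $$|f(x')-f(y')|\le c\,\|x'-y'\|_\infty^{\gamma}\qquad\text{for all }x',y'\in\left[-\tfrac{\delta}{2M},\tfrac{\delta}{2M}\right]^{d-1}.$$ Put $$D=\left\{(x',x_d)\in\left(-\tfrac{\delta}{2M},\tfrac{\delta}{2M}\right)^{d-1}\times(0,\delta)\;:\; x_d<f(x')\right\}\subset\mathbb R^d .$$ Then every complex-valued $u\in H^1(D)$ with $\int_D u=0$ satisfies $$\|u\|_{L^{q^*}(D)}^2\le C_{PS}\,M^{(d-1)\left(1-\frac{2}{q^*}\right)}\,\|\nabla u\|_{L^2(D)}^2 .$$ -/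

import Mathlib

open MeasureTheory Set
open scoped ContDiff

/-- `g` is the weak gradient of `u` on the open set `Ω ⊆ ℝ^d`: for every real test function
`φ ∈ C_c^∞(Ω)` and every coordinate `i` one has `∫_Ω u ∂ᵢφ = - ∫_Ω gᵢ φ`.
Points of `ℝ^d` are coordinate vectors `Fin d → ℝ`; the norm of that type is not used, while
the gradient takes values in `EuclideanSpace ℂ (Fin d)`, so that `‖g x‖` is the Euclidean
length `(∑ᵢ |gᵢ(x)|²)^(1/2)`. -/
def IsWeakGradient {d : ℕ} (Ω : Set (Fin d → ℝ)) (u : (Fin d → ℝ) → ℂ)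
    (g : (Fin d → ℝ) → EuclideanSpace ℂ (Fin d)) : Prop :=
  ∀ φ : (Fin d → ℝ) → ℝ, ContDiff ℝ ∞ φ → HasCompactSupport φ → tsupport φ ⊆ Ω →
    ∀ i : Fin d,
      ∫ x in Ω, (fderiv ℝ φ x (Pi.single i 1) : ℂ) * u x = - ∫ x in Ω, (φ x : ℂ) * g x i

/-- `u ∈ H¹(Ω)` with weak gradient `∇u = g`: both `u` and `g` are square integrable on `Ω`
(with respect to Lebesgue measure) and `g` is the weak gradient of `u` on `Ω`. -/
structure IsH1WithGradient {d : ℕ} (Ω : Set (Fin d → ℝ)) (u : (Fin d → ℝ) → ℂ)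
    (g : (Fin d → ℝ) → EuclideanSpace ℂ (Fin d)) : Prop where
  memLp : MemLp u 2 (volume.restrict Ω)
  memLp_grad : MemLp g 2 (volume.restrict Ω)
  isWeakGradient : IsWeakGradient Ω u g

/-- The oscillatory domain in `ℝ^d`, `d = n + 1`, of all points `x = (x', x_d)` with
`x' ∈ (-δ/(2M), δ/(2M))^(d-1)`, `x_d ∈ (0, δ)` and `f(x') > x_d`.
Here `x' = Fin.init x` and `x_d = x (Fin.last n)`. -/
def oscillatoryDomain {n : ℕ} (M δ : ℝ) (f : (Fin n → ℝ) → ℝ) : Set (Fin (n + 1) → ℝ) :=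
  {x | (∀ i : Fin n, Fin.init x i ∈ Ioo (-(δ / (2 * M))) (δ / (2 * M))) ∧
    x (Fin.last n) ∈ Ioo 0 δ ∧ x (Fin.last n) < f (Fin.init x)}

/-- The closed cube `[-δ/(2M), δ/(2M)]^n`. -/
def baseCube (n : ℕ) (M δ : ℝ) : Set (Fin n → ℝ) :=
  {x' | ∀ i : Fin n, x' i ∈ Icc (-(δ / (2 * M))) (δ / (2 * M))}

/-!
The exponent `q = 2D / (D - 2)` is the Sobolev exponent of the effective dimension
`D = n / γ + 1`: below the graph of a `γ`-Hölder function, a point `x` at depth `t` under itself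
still sees a horizontal cube of side of order `t^(1/γ)`, so that the region visible from `x` down
to depth `t` has volume of order `t^D`.

A point `x` of the domain is joined to every point `z` of a fixed box near the bottom by a path
which moves at constant speed in the last coordinate and spreads horizontally like `τ^(1/γ)`, until it is below the level
`δ/4` and may spread over the whole base (`IsHolderSubgraph.connectingPath_mem`). Integrating the
gradient along the paths and averaging over `z` bounds `|u(x) - m|`, where `m` is the mean of `u`
over the box, by the integral over `τ ∈ (0, 1)` of the means of `|∇u|` over boxes
`x + E τ` with `|E τ| ≥ a τ^D` (`IsHolderSubgraph.enorm_sub_average_le`).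

Such superpositions of averages map `L²` to `L^q`, with norm of order `a^(-1/D)`
(`lintegral_rpow_le_of_le_lintegral_translateAverage`). To bound the level set of height `λ`, the
integral over `τ` is cut at a scale where the tail is at most `λ/2` by Cauchy–Schwarz, and the
gradient `G` is cut at the height `h = c₀ λ^(q/2)`, below which it contributes at most `λ/4`;
Markov's inequality bounds the level set by `h⁻¹ ∫_{G > h} G`, and integration over the levels
gives `∫ G²` without logarithmic loss. The constant `a` is
bounded below in terms of `δ` and `M` in `IsHolderSubgraph.rpow_le_mul_volume`, which yields the
factor `M^(2n/D) = M^(n(1-2/q))`.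

All this is done for `C¹` functions on slightly smaller domains of the same kind. There the
mollification of a Sobolev function has the mollified weak gradient as its derivative
(`fderiv_mollify_single`), and Fatou's lemma gives the inequality on the full domain with some
constant subtracted from `u` (`exists_eLpNorm_sub_const_le`). As `u` has mean zero, subtracting a
constant at most halves its `L^q` norm (`eLpNorm_le_two_mul_eLpNorm_sub_const`).
-/

open Filter Topology
open scoped ENNReal Convolution

/-! ### Fractional integration over families of translates -/

/-- The mean value of `y ↦ G (x + y)` over the set `E τ`, in `[0, ∞]`; it is `0` when `E τ` is a
null set or has infinite measure. -/
noncomputable def translateAverage {V : Type*} [Add V] [MeasurableSpace V] (μ : Measure V)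
    (E : ℝ → Set V) (G : V → ℝ≥0∞) (τ : ℝ) (x : V) : ℝ≥0∞ :=
  (μ (E τ))⁻¹ * ∫⁻ y in E τ, G (x + y) ∂μ

/-- Integrating the level-set bound `|{F > λ}| ≤ h⁻¹ ∫_{G > h} G`, `h = c₀ λ^{q/2}`, against
`q λ^{q-1} dλ` gives a strong-type bound, with no loss at the endpoint. -/
lemma lintegral_rpow_le_of_measure_lt_le {V : Type*} [MeasurableSpace V]
    {μ : Measure V} [SFinite μ] {q c₀ : ℝ} (hq : 2 < q) (hc₀ : 0 < c₀)
    {G : V → ℝ≥0∞} (hG : Measurable G) (hGfin : ∀ x, G x ≠ ⊤) {F : V → ℝ} (hFm : Measurable F)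
    (hF0 : ∀ x, 0 ≤ F x)
    (hlev : ∀ l : ℝ, 0 < l → μ {x | l < F x} ≤ ENNReal.ofReal (c₀ * l ^ (q / 2))⁻¹ *
      ∫⁻ x, {x | ENNReal.ofReal (c₀ * l ^ (q / 2)) < G x}.indicator G x ∂μ) :
    ∫⁻ x, ENNReal.ofReal (F x ^ q) ∂μ ≤
      ENNReal.ofReal (2 / c₀ ^ 2) * ∫⁻ x, G x ^ (2 : ℝ) ∂μ := by
  have hq0 : 0 < q := by linarith
  rw [lintegral_rpow_eq_lintegral_meas_lt_mul μ (ae_of_all _ hF0) hFm.aemeasurable hq0]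
  set K : ℝ → V → ℝ≥0∞ := fun l x => ENNReal.ofReal (l ^ (q / 2 - 1) / c₀) *
    {x | ENNReal.ofReal (c₀ * l ^ (q / 2)) < G x}.indicator G x with hK
  have hKm : Measurable (Function.uncurry K) := by
    refine Measurable.mul (by fun_prop) ?_
    have : (fun p : ℝ × V => {x | ENNReal.ofReal (c₀ * p.1 ^ (q / 2)) < G x}.indicator G p.2)
        = {p : ℝ × V | ENNReal.ofReal (c₀ * p.1 ^ (q / 2)) < G p.2}.indicator
            (fun p => G p.2) := by
      ext p; simp [Set.indicator]
    change Measurable fun p : ℝ × V => _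
    rw [this]
    exact (hG.comp measurable_snd).indicator
      (measurableSet_lt (by fun_prop) (hG.comp measurable_snd))
  calc ENNReal.ofReal q * ∫⁻ l in Ioi 0, μ {x | l < F x} * ENNReal.ofReal (l ^ (q - 1))
      ≤ ENNReal.ofReal q * ∫⁻ l in Ioi 0, ∫⁻ x, K l x ∂μ := by
        gcongr ENNReal.ofReal q * ?_
        refine setLIntegral_mono' measurableSet_Ioi fun l hl => ?_
        have hl : 0 < l := hl
        have hGim : Measurable ({x | ENNReal.ofReal (c₀ * l ^ (q / 2)) < G x}.indicator G) :=
          hG.indicator (measurableSet_lt measurable_const hG)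
        rw [hK, lintegral_const_mul _ hGim]
        calc _ ≤ (ENNReal.ofReal (c₀ * l ^ (q / 2))⁻¹ *
              ∫⁻ x, {x | ENNReal.ofReal (c₀ * l ^ (q / 2)) < G x}.indicator G x ∂μ) *
                ENNReal.ofReal (l ^ (q - 1)) := by gcongr; exact hlev l hl
          _ = _ := by
            rw [mul_right_comm, ← ENNReal.ofReal_mul (by positivity)]
            congr 2
            rw [mul_inv, ← Real.rpow_neg hl.le, mul_assoc, ← Real.rpow_add hl]
            rw [div_eq_inv_mul]; ring_nf
    _ = ENNReal.ofReal q * ∫⁻ x, (∫⁻ l in Ioi 0, K l x) ∂μ := by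
        rw [lintegral_lintegral_swap hKm.aemeasurable]
    _ ≤ ENNReal.ofReal q * ∫⁻ x, ENNReal.ofReal (2 / (q * c₀ ^ 2)) * G x ^ (2 : ℝ) ∂μ := by
        gcongr with x
        set γ : ℝ := (G x).toReal with hγ
        have hγ0 : 0 ≤ γ := ENNReal.toReal_nonneg
        have hGx : G x = ENNReal.ofReal γ := (ENNReal.ofReal_toReal (hGfin x)).symm
        set L : ℝ := (γ / c₀) ^ (2 / q) with hL
        have hL0 : 0 ≤ L := by positivity
        calc ∫⁻ l in Ioi 0, K l x
            ≤ ∫⁻ l in Ioi 0, (Ioc 0 L).indicator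
                (fun l => ENNReal.ofReal (l ^ (q / 2 - 1) / c₀ * γ)) l := by
              refine setLIntegral_mono' measurableSet_Ioi fun l hl => ?_
              have hl : 0 < l := hl
              simp only [hK]
              by_cases hlt : ENNReal.ofReal (c₀ * l ^ (q / 2)) < G x
              · have hmem : l ∈ Ioc 0 L := by
                  refine ⟨hl, ?_⟩
                  rw [hGx] at hlt
                  have h1 := (ENNReal.ofReal_lt_ofReal_iff_of_nonneg (by positivity)).1 hlt
                  have h2 : l ^ (q / 2) ≤ γ / c₀ := by
                    rw [le_div_iff₀ hc₀]; linarith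
                  calc l = (l ^ (q / 2)) ^ (2 / q) := by
                        rw [← Real.rpow_mul hl.le]
                        rw [show q / 2 * (2 / q) = 1 by field_simp]; simp
                    _ ≤ L := by rw [hL]; gcongr
                rw [indicator_of_mem (by exact hlt), indicator_of_mem hmem, hGx,
                  ← ENNReal.ofReal_mul (by positivity)]
              · rw [indicator_of_notMem (by exact hlt)]; simp
          _ = ∫⁻ l in Ioc 0 L, ENNReal.ofReal (l ^ (q / 2 - 1) / c₀ * γ) := by
              rw [lintegral_indicator measurableSet_Ioc, Measure.restrict_restrict
                measurableSet_Ioc, inter_eq_left.2 Ioc_subset_Ioi_self]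
          _ = ENNReal.ofReal (∫ l in Ioc 0 L, l ^ (q / 2 - 1) / c₀ * γ) := by
              rw [ofReal_integral_eq_lintegral_ofReal]
              · have := (intervalIntegral.intervalIntegrable_rpow' (a := 0) (b := L)
                  (r := q / 2 - 1) (by linarith))
                rw [intervalIntegrable_iff_integrableOn_Ioc_of_le hL0] at this
                exact (this.div_const _).mul_const _
              · filter_upwards [ae_restrict_mem measurableSet_Ioc] with l hl
                have : 0 < l := hl.1
                simp only [Pi.zero_apply]; positivity
          _ = ENNReal.ofReal (2 / (q * c₀ ^ 2) * γ ^ (2 : ℝ)) := by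
              congr 1
              rw [integral_mul_const, integral_div, ← intervalIntegral.integral_of_le hL0,
                integral_rpow (Or.inl (by linarith))]
              rw [show q / 2 - 1 + 1 = q / 2 by ring, Real.zero_rpow (by positivity), hL,
                ← Real.rpow_mul (by positivity), show 2 / q * (q / 2) = 1 by field_simp,
                Real.rpow_one, Real.rpow_two]
              field_simp
              ring
          _ = _ := by
              rw [hGx, ENNReal.ofReal_mul (by positivity), ENNReal.ofReal_rpow_of_nonneg hγ0
                (by norm_num)]
    _ = _ := by
        rw [lintegral_const_mul _ (by fun_prop), ← mul_assoc, ← ENNReal.ofReal_mul (by positivity)]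
        congr 2
        field_simp

section FractionalIntegration

variable {V : Type*} [AddCommGroup V] [MeasurableSpace V] {μ : Measure V} {E : ℝ → Set V}

lemma translateAverage_const_le (h : ℝ≥0∞) (τ : ℝ) (x : V) :
    translateAverage μ E (fun _ => h) τ x ≤ h := by
  unfold translateAverage
  rw [lintegral_const, Measure.restrict_apply_univ, mul_left_comm]
  exact (mul_le_mul_right (ENNReal.inv_mul_le_one _) h).trans_eq (mul_one h)

lemma lintegral_Ioo_translateAverage_le_add {G G' : V → ℝ≥0∞} {h : ℝ≥0∞}
    (hGle : ∀ x, G x ≤ h + G' x) (ε : ℝ) (x : V) :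
    ∫⁻ τ in Ioo 0 ε, translateAverage μ E G τ x ≤
      h * ENNReal.ofReal ε + ∫⁻ τ in Ioo 0 ε, translateAverage μ E G' τ x := by
  calc ∫⁻ τ in Ioo 0 ε, translateAverage μ E G τ x
      ≤ ∫⁻ τ in Ioo 0 ε, (h + translateAverage μ E G' τ x) := by
        refine lintegral_mono fun τ => ?_
        calc translateAverage μ E G τ x
            ≤ translateAverage μ E (fun _ => h) τ x + translateAverage μ E G' τ x := by
              unfold translateAverage
              rw [← mul_add, ← lintegral_add_left measurable_const]
              exact mul_le_mul_right (lintegral_mono fun y => hGle _) _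
          _ ≤ h + translateAverage μ E G' τ x :=
              add_le_add (translateAverage_const_le h τ x) le_rfl
    _ = _ := by
        rw [lintegral_add_left measurable_const, lintegral_const,
          Measure.restrict_apply_univ, Real.volume_Ioo, sub_zero]

variable [MeasurableAdd₂ V]

/-- The Cauchy–Schwarz bound for a single average. -/
lemma translateAverage_le_rpow_mul [μ.IsAddRightInvariant] {G : V → ℝ≥0∞} (hG : Measurable G)
    {τ : ℝ} (h0 : μ (E τ) ≠ 0) {N : ℝ≥0∞} (hN : ∫⁻ x, G x ^ (2 : ℝ) ∂μ ≤ N ^ (2 : ℝ)) (x : V) :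
    translateAverage μ E G τ x ≤ (μ (E τ)) ^ (-(1 / 2) : ℝ) * N := by
  unfold translateAverage
  by_cases ht : μ (E τ) = ⊤
  · simp [ht]
  have h1 : ∫⁻ y in E τ, G (x + y) ∂μ ≤ μ (E τ) ^ (1 / 2 : ℝ) * N := by
    have := ENNReal.lintegral_mul_le_Lp_mul_Lq (μ.restrict (E τ)) Real.HolderConjugate.two_two
      (f := fun _ => 1) (g := fun y => G (x + y)) (by fun_prop) (by fun_prop)
    simp only [Pi.mul_apply, one_mul, ENNReal.one_rpow, lintegral_const,
      Measure.restrict_apply_univ] at this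
    refine this.trans ?_
    gcongr
    calc (∫⁻ y in E τ, G (x + y) ^ (2 : ℝ) ∂μ) ^ (1 / 2 : ℝ)
        ≤ (∫⁻ y, G (x + y) ^ (2 : ℝ) ∂μ) ^ (1 / 2 : ℝ) := by
          gcongr; exact Measure.restrict_le_self
      _ = (∫⁻ y, G y ^ (2 : ℝ) ∂μ) ^ (1 / 2 : ℝ) := by
          simp_rw [add_comm x]
          rw [lintegral_add_right_eq_self (fun y => G y ^ (2 : ℝ)) x]
      _ ≤ (N ^ (2 : ℝ)) ^ (1 / 2 : ℝ) := by gcongr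
      _ = N := by rw [← ENNReal.rpow_mul]; norm_num
  calc (μ (E τ))⁻¹ * ∫⁻ y in E τ, G (x + y) ∂μ ≤ (μ (E τ))⁻¹ * (μ (E τ) ^ (1 / 2 : ℝ) * N) := by
        gcongr
    _ = _ := by
        rw [← mul_assoc, ← ENNReal.rpow_neg_one, ← ENNReal.rpow_add _ _ h0 ht]
        norm_num

/-- The contribution of the scales `τ > ε`, which converges because `D > 2`. -/
lemma lintegral_translateAverage_tail_le [μ.IsAddRightInvariant] {D a N : ℝ} (hD : 2 < D)
    (ha : 0 < a) (hN : 0 < N)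
    (hvol : ∀ τ ∈ Ioo (0 : ℝ) 1, ENNReal.ofReal (a * τ ^ D) ≤ μ (E τ))
    {G : V → ℝ≥0∞} (hG : Measurable G)
    (hGN : ∫⁻ x, G x ^ (2 : ℝ) ∂μ ≤ ENNReal.ofReal N ^ (2 : ℝ)) (x : V) {ε : ℝ} (hε : 0 < ε) :
    ∫⁻ τ in Ioo (0 : ℝ) 1 ∩ Ioi ε, translateAverage μ E G τ x
      ≤ ENNReal.ofReal (a ^ (-(1 / 2) : ℝ) * N * (ε ^ (1 - D / 2) / (D / 2 - 1))) := by
  have hD2 : -(D / 2) < -1 := by linarith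
  calc ∫⁻ τ in Ioo (0 : ℝ) 1 ∩ Ioi ε, translateAverage μ E G τ x
      ≤ ∫⁻ τ in Ioo (0 : ℝ) 1 ∩ Ioi ε,
          ENNReal.ofReal (a ^ (-(1 / 2) : ℝ) * N * τ ^ (-(D / 2))) := by
        refine setLIntegral_mono' (measurableSet_Ioo.inter measurableSet_Ioi) fun τ hτ => ?_
        have hτ0 : 0 < τ := hτ.1.1
        have hpos : 0 < a * τ ^ D := by positivity
        have hv := hvol τ hτ.1
        refine (translateAverage_le_rpow_mul hG
          ((ENNReal.ofReal_pos.2 hpos).trans_le hv).ne' hGN x).trans ?_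
        calc μ (E τ) ^ (-(1 / 2) : ℝ) * ENNReal.ofReal N
            ≤ ENNReal.ofReal (a * τ ^ D) ^ (-(1 / 2) : ℝ) * ENNReal.ofReal N := by
              gcongr ?_ * _
              rw [ENNReal.rpow_neg, ENNReal.rpow_neg]
              gcongr
          _ = _ := by
              rw [ENNReal.ofReal_rpow_of_pos hpos, ← ENNReal.ofReal_mul (by positivity),
                Real.mul_rpow ha.le (by positivity), ← Real.rpow_mul hτ0.le]
              congr 1
              ring_nf
    _ ≤ ∫⁻ τ in Ioi ε, ENNReal.ofReal (a ^ (-(1 / 2) : ℝ) * N * τ ^ (-(D / 2))) :=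
        lintegral_mono_set inter_subset_right
    _ = ENNReal.ofReal (∫ τ in Ioi ε, a ^ (-(1 / 2) : ℝ) * N * τ ^ (-(D / 2))) := by
        rw [ofReal_integral_eq_lintegral_ofReal]
        · exact (integrableOn_Ioi_rpow_of_lt hD2 hε).const_mul _
        · filter_upwards [ae_restrict_mem measurableSet_Ioi] with τ hτ
          have : 0 < τ := hε.trans hτ
          simp only [Pi.zero_apply]; positivity
    _ = _ := by
        rw [integral_const_mul, integral_Ioi_rpow_of_lt hD2 hε]
        congr 2
        rw [show -(D / 2) + 1 = -(D / 2 - 1) by ring, neg_div_neg_eq]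
        ring_nf

variable [SFinite μ]

lemma measurable_translateAverage (hE : MeasurableSet {p : ℝ × V | p.2 ∈ E p.1})
    {G : V → ℝ≥0∞} (hG : Measurable G) :
    Measurable fun p : ℝ × V => translateAverage μ E G p.1 p.2 := by
  unfold translateAverage
  have h1 : Measurable fun τ : ℝ => μ (E τ) := measurable_measure_prodMk_left hE
  have hEτ : ∀ τ, MeasurableSet (E τ) := fun τ => measurable_prodMk_left hE
  have h2 : Measurable fun p : ℝ × V => ∫⁻ y, (E p.1).indicator (fun y => G (p.2 + y)) y ∂μ := by
    refine Measurable.lintegral_prod_right' (f := fun r : (ℝ × V) × V =>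
      (E r.1.1).indicator (fun y => G (r.1.2 + y)) r.2) ?_
    have : (fun r : (ℝ × V) × V => (E r.1.1).indicator (fun y => G (r.1.2 + y)) r.2)
        = Set.indicator {r : (ℝ × V) × V | r.2 ∈ E r.1.1} (fun r => G (r.1.2 + r.2)) := by
      ext r; simp [Set.indicator]
    rw [this]
    refine Measurable.indicator (by fun_prop) ?_
    exact (measurable_fst.fst.prodMk measurable_snd) hE
  refine (h1.comp measurable_fst).inv.mul ?_
  convert h2 using 2 with p
  rw [lintegral_indicator (hEτ _)]

variable [μ.IsAddRightInvariant]

lemma lintegral_translateAverage_le {G : V → ℝ≥0∞} (hG : Measurable G) (τ : ℝ) :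
    ∫⁻ x, translateAverage μ E G τ x ∂μ ≤ ∫⁻ x, G x ∂μ := by
  unfold translateAverage
  have hm : Measurable fun p : V × V => G (p.1 + p.2) := by fun_prop
  rw [lintegral_const_mul _ (hm.lintegral_prod_right' (ν := μ.restrict (E τ))),
    lintegral_lintegral_swap hm.aemeasurable]
  simp only [lintegral_add_right_eq_self]
  rw [lintegral_const, Measure.restrict_apply_univ, mul_left_comm]
  exact (mul_le_mul_right (ENNReal.inv_mul_le_one _) _).trans_eq (mul_one _)

/-- If the scales `τ > ε` contribute at most `l / 2`, then only the part of `G` above the height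
`l / (4 ε)` matters for the level set of `F` at `l`, because the rest of `G` contributes at most
`l / 4` through the scales `τ ≤ ε`. -/
lemma measure_lt_le_of_le_lintegral_translateAverage
    (hE : MeasurableSet {p : ℝ × V | p.2 ∈ E p.1})
    {G : V → ℝ≥0∞} (hG : Measurable G) {F : V → ℝ}
    (hF : ∀ x, ENNReal.ofReal (F x) ≤ ∫⁻ τ in Ioo (0 : ℝ) 1, translateAverage μ E G τ x)
    {ε l : ℝ} (hε : 0 < ε) (hl : 0 < l)
    (htail : ∀ x, ∫⁻ τ in Ioo (0 : ℝ) 1 ∩ Ioi ε, translateAverage μ E G τ x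
      ≤ ENNReal.ofReal (l / 2)) :
    μ {x | l < F x} ≤ ENNReal.ofReal (4 * ε / l) *
      ∫⁻ x, {x | ENNReal.ofReal (l / (4 * ε)) < G x}.indicator G x ∂μ := by
  set h : ℝ≥0∞ := ENNReal.ofReal (l / (4 * ε)) with hh
  set G' : V → ℝ≥0∞ := {x | h < G x}.indicator G with hG'
  have hG'm : Measurable G' := hG.indicator (measurableSet_lt measurable_const hG)
  have hGle : ∀ x, G x ≤ h + G' x := by
    intro x
    by_cases hx : h < G x
    · rw [hG', indicator_of_mem (by exact hx)]; exact le_add_self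
    · exact (not_lt.1 hx).trans le_self_add
  set W : V → ℝ≥0∞ := fun x => ∫⁻ τ in Ioo 0 ε, translateAverage μ E G' τ x with hW
  have hWm : Measurable fun p : V × ℝ => translateAverage μ E G' p.2 p.1 :=
    (measurable_translateAverage hE hG'm).comp measurable_swap
  have hW1 : ∫⁻ x, W x ∂μ ≤ ENNReal.ofReal ε * ∫⁻ x, G' x ∂μ := by
    rw [hW, lintegral_lintegral_swap hWm.aemeasurable]
    calc _ ≤ ∫⁻ _ in Ioo 0 ε, ∫⁻ x, G' x ∂μ :=
          lintegral_mono fun τ => lintegral_translateAverage_le hG'm τ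
      _ = _ := by rw [lintegral_const, Measure.restrict_apply_univ, Real.volume_Ioo, sub_zero,
                    mul_comm]
  have hsub : {x | l < F x} ⊆ {x | ENNReal.ofReal (l / 4) ≤ W x} := by
    intro x hx
    by_contra hlt
    simp only [mem_ofPred_eq, not_le] at hx hlt
    have hsplit : ∫⁻ τ in Ioo (0 : ℝ) 1, translateAverage μ E G τ x ≤
        (ENNReal.ofReal (l / 4) + W x) + ENNReal.ofReal (l / 2) := by
      calc _ ≤ ∫⁻ τ in Ioc 0 ε ∪ (Ioo (0 : ℝ) 1 ∩ Ioi ε), translateAverage μ E G τ x := by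
            refine lintegral_mono_set fun τ hτ => ?_
            rcases le_or_gt τ ε with h' | h'
            · exact Or.inl ⟨hτ.1, h'⟩
            · exact Or.inr ⟨hτ, h'⟩
        _ ≤ (∫⁻ τ in Ioc 0 ε, translateAverage μ E G τ x) + ENNReal.ofReal (l / 2) :=
            (lintegral_union_le _ _ _).trans (add_le_add le_rfl (htail x))
        _ ≤ _ := by
            refine add_le_add ?_ le_rfl
            rw [setLIntegral_congr Ioo_ae_eq_Ioc.symm]
            refine (lintegral_Ioo_translateAverage_le_add hGle ε x).trans_eq ?_
            rw [hh, ← ENNReal.ofReal_mul (by positivity),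
              show l / (4 * ε) * ε = l / 4 by field_simp]
    have : ENNReal.ofReal (F x) < ENNReal.ofReal l := by
      calc _ ≤ _ := (hF x).trans hsplit
        _ < (ENNReal.ofReal (l / 4) + ENNReal.ofReal (l / 4)) + ENNReal.ofReal (l / 2) := by
            refine ENNReal.add_lt_add_right ENNReal.ofReal_ne_top ?_
            exact ENNReal.add_lt_add_left ENNReal.ofReal_ne_top hlt
        _ = ENNReal.ofReal l := by
            rw [← ENNReal.ofReal_add (by positivity) (by positivity),
              ← ENNReal.ofReal_add (by positivity) (by positivity)]
            congr 1; ring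
    exact (this.trans_le (ENNReal.ofReal_le_ofReal hx.le)).false
  have hmk : ENNReal.ofReal (l / 4) * μ {x | l < F x} ≤ ENNReal.ofReal ε * ∫⁻ x, G' x ∂μ :=
    calc _ ≤ ENNReal.ofReal (l / 4) * μ {x | ENNReal.ofReal (l / 4) ≤ W x} := by gcongr
      _ ≤ ∫⁻ x, W x ∂μ := mul_meas_ge_le_lintegral hWm.lintegral_prod_right' _
      _ ≤ _ := hW1
  calc μ {x | l < F x}
      = ENNReal.ofReal (4 / l) * (ENNReal.ofReal (l / 4) * μ {x | l < F x}) := by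
        rw [← mul_assoc, ← ENNReal.ofReal_mul (by positivity)]
        rw [show 4 / l * (l / 4) = 1 by field_simp]; simp
    _ ≤ ENNReal.ofReal (4 / l) * (ENNReal.ofReal ε * ∫⁻ x, G' x ∂μ) := by gcongr
    _ = _ := by
        rw [← mul_assoc, ← ENNReal.ofReal_mul (by positivity)]
        congr 2; ring

/-- The critical fractional integration inequality `L² → L^q`, `q = 2D / (D - 2)`: a function
dominated by the superposition over scales `τ ∈ (0, 1)` of averages over sets of volume at least
`a τ^D` lies in `L^q` when the averaged function is in `L²`. -/
theorem lintegral_rpow_le_of_le_lintegral_translateAverage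
    (hE : MeasurableSet {p : ℝ × V | p.2 ∈ E p.1})
    {D a N q : ℝ} (hD : 2 < D) (hq : q = 2 * D / (D - 2)) (ha : 0 < a) (hN : 0 < N)
    (hvol : ∀ τ ∈ Ioo (0 : ℝ) 1, ENNReal.ofReal (a * τ ^ D) ≤ μ (E τ))
    {G : V → ℝ≥0∞} (hG : Measurable G) (hGfin : ∀ x, G x ≠ ⊤)
    (hGN : ∫⁻ x, G x ^ (2 : ℝ) ∂μ ≤ ENNReal.ofReal N ^ (2 : ℝ))
    {F : V → ℝ} (hFm : Measurable F) (hF0 : ∀ x, 0 ≤ F x)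
    (hF : ∀ x, ENNReal.ofReal (F x) ≤ ∫⁻ τ in Ioo (0 : ℝ) 1, translateAverage μ E G τ x) :
    ∫⁻ x, ENNReal.ofReal (F x ^ q) ∂μ ≤
      ENNReal.ofReal ((32 * (4 / (D - 2)) ^ (4 / (D - 2))) *
        (a ^ (-(q / D)) * N ^ q)) := by
  have hD2 : 0 < D - 2 := by linarith
  have hqD : q / 2 = 1 + 2 / (D - 2) := by rw [hq]; field_simp; ring
  have hq2 : 2 < q := by
    have : 0 < 2 / (D - 2) := by positivity
    linarith
  -- `A` is chosen so that the part `τ > (l / A) ^ (-2 / (D - 2))` contributes at most `l / 2`.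
  set A : ℝ := 4 / (D - 2) * (N * a ^ (-(1 / 2) : ℝ)) with hA
  have hA0 : 0 < A := by positivity
  set c₀ : ℝ := A ^ (-(2 / (D - 2))) / 4 with hc₀
  have hc₀0 : 0 < c₀ := by positivity
  have main := lintegral_rpow_le_of_measure_lt_le (μ := μ) hq2 hc₀0 hG hGfin hFm hF0 (fun l hl => by
    set ε : ℝ := (l / A) ^ (-(2 / (D - 2))) with hε
    have hε0 : 0 < ε := by positivity
    have key := measure_lt_le_of_le_lintegral_translateAverage (μ := μ) hE hG hF hε0 hl (fun x => by
      refine (lintegral_translateAverage_tail_le hD ha hN hvol hG hGN x hε0).trans_eq ?_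
      congr 1
      rw [hε, ← Real.rpow_mul (by positivity),
        show -(2 / (D - 2)) * (1 - D / 2) = 1 by field_simp; ring, Real.rpow_one, hA]
      field_simp
      ring)
    have e1 : l / (4 * ε) = c₀ * l ^ (q / 2) := by
      rw [hqD, Real.rpow_add hl, Real.rpow_one, hε, hc₀, Real.rpow_neg (by positivity),
        Real.div_rpow hl.le hA0.le, Real.rpow_neg hA0.le]
      field_simp
    rw [show 4 * ε / l = (l / (4 * ε))⁻¹ by rw [inv_div], e1] at key
    exact key)
  refine main.trans ?_
  calc _ ≤ ENNReal.ofReal (2 / c₀ ^ 2) * ENNReal.ofReal N ^ (2 : ℝ) := by gcongr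
    _ = ENNReal.ofReal (2 / c₀ ^ 2 * N ^ (2 : ℝ)) := by
        rw [ENNReal.ofReal_rpow_of_pos hN, ENNReal.ofReal_mul (by positivity)]
    _ = _ := by
        congr 1
        have e2 : 2 / c₀ ^ 2 = 32 * A ^ (4 / (D - 2)) := by
          rw [hc₀, Real.rpow_neg hA0.le, ← Real.rpow_two,
            Real.div_rpow (by positivity) (by norm_num),
            Real.inv_rpow (by positivity), ← Real.rpow_mul hA0.le,
            show 2 / (D - 2) * 2 = 4 / (D - 2) by ring]
          field_simp
          norm_num
        have e3 : q = 4 / (D - 2) + 2 := by rw [hq]; field_simp; ring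
        have e4 : q / D = 1 / 2 * (4 / (D - 2)) := by
          rw [hq]; field_simp; ring
        rw [e2, hA, Real.mul_rpow (by positivity) (by positivity),
          Real.mul_rpow (by positivity) (by positivity), ← Real.rpow_mul ha.le, e4]
        rw [show N ^ q = N ^ (4 / (D - 2)) * N ^ (2 : ℝ) by rw [← Real.rpow_add hN, ← e3]]
        rw [show -(1 / 2) * (4 / (D - 2)) = -(1 / 2 * (4 / (D - 2))) by ring]
        ring

end FractionalIntegration

/-! ### Connecting paths in Hölder subgraphs -/

/-- The horizontal speed profile of the connecting paths, for `τ ∈ [0, 1]`. It equals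
`κ τ^(1/γ)` for `τ ≤ 13/14`, so that the path stays below a `γ`-Hölder graph, and then grows
to `1`, so that the endpoint is an arbitrary point of a fixed box. -/
noncomputable def horizontalProfile (γ κ τ : ℝ) : ℝ :=
  κ * τ ^ (1 / γ) + (1 - κ) * (max 0 (14 * τ - 13)) ^ 2

/-- The derivative of `horizontalProfile γ κ`. -/
noncomputable def horizontalProfileDeriv (γ κ τ : ℝ) : ℝ :=
  κ * (1 / γ * τ ^ (1 / γ - 1)) + (1 - κ) * (28 * max 0 (14 * τ - 13))

section Profile

variable {γ κ : ℝ}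

lemma horizontalProfile_zero (hγ : 0 < γ) : horizontalProfile γ κ 0 = 0 := by
  unfold horizontalProfile
  rw [Real.zero_rpow (by positivity)]
  norm_num

lemma horizontalProfile_one : horizontalProfile γ κ 1 = 1 := by
  unfold horizontalProfile
  norm_num

lemma mul_rpow_le_horizontalProfile (hκ1 : κ ≤ 1) (τ : ℝ) :
    κ * τ ^ (1 / γ) ≤ horizontalProfile γ κ τ := by
  have : 0 ≤ (1 - κ) * (max 0 (14 * τ - 13)) ^ 2 := mul_nonneg (by linarith) (sq_nonneg _)
  unfold horizontalProfile
  linarith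

lemma horizontalProfile_eq_of_le {τ : ℝ} (hτ : τ ≤ 13 / 14) :
    horizontalProfile γ κ τ = κ * τ ^ (1 / γ) := by
  unfold horizontalProfile
  rw [max_eq_left (by linarith)]
  ring

lemma horizontalProfile_mem_Icc (hγ : 0 < γ) (hκ0 : 0 ≤ κ) (hκ1 : κ ≤ 1) {τ : ℝ}
    (hτ : τ ∈ Icc (0 : ℝ) 1) : horizontalProfile γ κ τ ∈ Icc (0 : ℝ) 1 := by
  have h0 := hτ.1
  constructor
  · exact le_trans (by positivity) (mul_rpow_le_horizontalProfile hκ1 τ)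
  · have h1 : τ ^ (1 / γ) ≤ 1 := Real.rpow_le_one h0 hτ.2 (by positivity)
    have h2 : (max 0 (14 * τ - 13)) ^ 2 ≤ 1 :=
      pow_le_one₀ (le_max_left _ _) (max_le zero_le_one (by linarith [hτ.2]))
    unfold horizontalProfile
    nlinarith

lemma hasDerivAt_max_zero_sq (y : ℝ) :
    HasDerivAt (fun x : ℝ => (max 0 x) ^ 2) (2 * max 0 y) y := by
  rcases lt_trichotomy y 0 with hy | rfl | hy
  · rw [max_eq_left hy.le, mul_zero]
    refine (hasDerivAt_const y (0 : ℝ)).congr_of_eventuallyEq ?_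
    filter_upwards [Iio_mem_nhds hy] with x hx
    rw [max_eq_left (le_of_lt hx)]; norm_num
  · rw [max_self, mul_zero]
    have h : (fun x : ℝ => (max 0 x) ^ 2) =o[nhds 0] fun x : ℝ => x := by
      have h1 : (fun x : ℝ => x ^ 2) =o[nhds 0] fun x : ℝ => x := by
        simpa using (Asymptotics.isLittleO_pow_id (𝕜 := ℝ) (n := 2) (by norm_num))
      refine Asymptotics.IsBigO.trans_isLittleO
        (Asymptotics.IsBigO.of_bound 1 (Filter.Eventually.of_forall fun x => ?_)) h1
      rw [one_mul, Real.norm_of_nonneg (sq_nonneg _), Real.norm_of_nonneg (sq_nonneg _)]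
      rcases le_total x 0 with h | h
      · rw [max_eq_left h, sq (0 : ℝ), mul_zero]; exact sq_nonneg x
      · rw [max_eq_right h]
    rw [hasDerivAt_iff_isLittleO]
    simpa using h
  · rw [max_eq_right hy.le]
    have := (hasDerivAt_pow 2 y)
    refine HasDerivAt.congr_of_eventuallyEq (f := fun x : ℝ => x ^ 2) (by simpa using this) ?_
    filter_upwards [Ioi_mem_nhds hy] with x hx
    rw [max_eq_right (le_of_lt hx)]

lemma hasDerivAt_horizontalProfile (hγ : γ ∈ Ioo (0 : ℝ) 1) (τ : ℝ) :
    HasDerivAt (horizontalProfile γ κ) (horizontalProfileDeriv γ κ τ) τ := by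
  have h1 : 1 ≤ 1 / γ := by rw [le_div_iff₀ hγ.1]; linarith [hγ.2]
  have hr := (Real.hasDerivAt_rpow_const (x := τ) (p := 1 / γ) (Or.inr h1)).const_mul κ
  have hl : HasDerivAt (fun τ : ℝ => 14 * τ - 13) 14 τ := by
    simpa using ((hasDerivAt_id τ).const_mul 14).sub_const 13
  have hm := ((hasDerivAt_max_zero_sq (14 * τ - 13)).comp τ hl).const_mul (1 - κ)
  convert! hr.add hm using 1
  unfold horizontalProfileDeriv
  ring

lemma continuous_horizontalProfile (hγ : 0 < γ) : Continuous (horizontalProfile γ κ) := by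
  unfold horizontalProfile
  have : Continuous fun τ : ℝ => τ ^ (1 / γ) := Real.continuous_rpow_const (by positivity)
  fun_prop

lemma continuous_horizontalProfileDeriv (hγ : γ ∈ Ioo (0 : ℝ) 1) :
    Continuous (horizontalProfileDeriv γ κ) := by
  unfold horizontalProfileDeriv
  have h1 : 1 ≤ 1 / γ := by rw [le_div_iff₀ hγ.1]; linarith [hγ.2]
  have : Continuous fun τ : ℝ => τ ^ (1 / γ - 1) := Real.continuous_rpow_const (by linarith)
  fun_prop

lemma abs_horizontalProfileDeriv_le (hγ : γ ∈ Ioo (0 : ℝ) 1) (hκ0 : 0 ≤ κ) (hκ1 : κ ≤ 1) {τ : ℝ}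
    (hτ : τ ∈ Icc (0 : ℝ) 1) : |horizontalProfileDeriv γ κ τ| ≤ 1 / γ + 28 := by
  have hγ0 := hγ.1
  have h1 : 1 ≤ 1 / γ := by rw [le_div_iff₀ hγ.1]; linarith [hγ.2]
  have h0 := hτ.1
  have h2 : τ ^ (1 / γ - 1) ≤ 1 := Real.rpow_le_one h0 hτ.2 (by linarith)
  have h3 : max 0 (14 * τ - 13) ≤ 1 := max_le zero_le_one (by linarith [hτ.2])
  have h4 : 0 ≤ max 0 (14 * τ - 13) := le_max_left _ _
  have h5 : 0 ≤ τ ^ (1 / γ - 1) := by positivity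
  have h6 : 1 / γ * τ ^ (1 / γ - 1) ≤ 1 / γ := mul_le_of_le_one_right (by positivity) h2
  have h7 : 0 ≤ 1 / γ * τ ^ (1 / γ - 1) := by positivity
  have h8 : 0 ≤ 1 - κ := by linarith
  unfold horizontalProfileDeriv
  rw [abs_of_nonneg (by positivity)]
  have h9 : κ * (1 / γ * τ ^ (1 / γ - 1)) ≤ 1 * (1 / γ) := by gcongr
  have h10 : (1 - κ) * (28 * max 0 (14 * τ - 13)) ≤ 1 * (28 * 1) := by
    gcongr
    linarith
  linarith

end Profile

/-- The vector `(a, …, a, b)` of `ℝ^(n+1)`. -/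
def horizVert {n : ℕ} (a b : ℝ) : Fin (n + 1) → ℝ := Fin.snoc (α := fun _ => ℝ) (fun _ => a) b

section HorizVert

variable {n : ℕ} {a b : ℝ}

@[simp] lemma horizVert_castSucc (i : Fin n) : horizVert a b i.castSucc = a := by
  simp [horizVert]

@[simp] lemma horizVert_last : horizVert a b (Fin.last n) = b := by
  simp [horizVert]

lemma prod_horizVert : ∏ i : Fin (n + 1), horizVert a b i = a ^ n * b := by
  simp [Fin.prod_univ_castSucc]

lemma horizVert_pos (ha : 0 < a) (hb : 0 < b) (i : Fin (n + 1)) : 0 < horizVert a b i := by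
  induction i using Fin.lastCases <;> simp [ha, hb]

end HorizVert

/-- The part `s < x_d < f(x') - t` of the subgraph of `f` over the open cube `(-W, W)^n`. -/
def subgraphDomain {n : ℕ} (W s t : ℝ) (f : (Fin n → ℝ) → ℝ) : Set (Fin (n + 1) → ℝ) :=
  {x | (∀ i : Fin n, x i.castSucc ∈ Ioo (-W) W) ∧ s < x (Fin.last n) ∧
    x (Fin.last n) < f (Fin.init x) - t}

/-- The box `(-W, W)^n × (s, h)`. -/
def referenceBox (n : ℕ) (W s h : ℝ) : Set (Fin (n + 1) → ℝ) :=
  univ.pi fun i => Ioo (horizVert (-W) s i) (horizVert W h i)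

/-- The connecting path from `x` (at `τ = 0`) to `z` (at `τ = 1`): it moves with constant speed
in the last coordinate and according to `horizontalProfile` in the others. -/
noncomputable def connectingPath {n : ℕ} (γ κ : ℝ) (x z : Fin (n + 1) → ℝ) (τ : ℝ) :
    Fin (n + 1) → ℝ :=
  x + horizVert (horizontalProfile γ κ τ) τ * (z - x)

/-- The standing assumptions on the subgraph domains: the base cube `(-W, W)^n` is no wider than
the scale `δ` of the heights, `f` takes values in `[δ/4, δ)` and is `γ`-Hölder, and the cut-off
heights `s`, `t` are small. -/
structure IsHolderSubgraph {n : ℕ} (c γ δ W s t : ℝ) (f : (Fin n → ℝ) → ℝ) : Prop where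
  hc : 0 < c
  hγ : γ ∈ Ioo (0 : ℝ) 1
  hδ : δ ∈ Ioo (0 : ℝ) 1
  hW : 0 < W
  hWδ : 2 * W ≤ δ
  hs : s ∈ Icc 0 (δ / 16)
  ht : t ∈ Icc 0 (δ / 16)
  bounds : ∀ x', (∀ i, x' i ∈ Ioo (-W) W) → f x' ∈ Ico (δ / 4) δ
  holder : ∀ x', (∀ i, x' i ∈ Ioo (-W) W) → ∀ y', (∀ i, y' i ∈ Ioo (-W) W) →
    |f x' - f y'| ≤ c * ‖x' - y'‖ ^ γ

/-- The largest `κ ≤ 1` for which a horizontal displacement by `2 W κ` changes a `γ`-Hölder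
function with constant `c` by at most `δ / 16`. -/
noncomputable def spreadFactor (c γ δ W : ℝ) : ℝ := min 1 ((δ / (16 * c)) ^ (1 / γ) / (2 * W))

namespace IsHolderSubgraph

variable {n : ℕ} {c γ δ W s t : ℝ} {f : (Fin n → ℝ) → ℝ}

lemma spreadFactor_pos (h : IsHolderSubgraph c γ δ W s t f) : 0 < spreadFactor c γ δ W := by
  have := h.hc; have := h.hδ.1; have := h.hW
  unfold spreadFactor
  positivity

lemma mul_spreadFactor_rpow_le (h : IsHolderSubgraph c γ δ W s t f) :
    c * (2 * W * spreadFactor c γ δ W) ^ γ ≤ δ / 16 := by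
  have hc := h.hc; have hδ := h.hδ.1; have hW := h.hW; have hγ := h.hγ.1
  have h1 : 2 * W * spreadFactor c γ δ W ≤ (δ / (16 * c)) ^ (1 / γ) := by
    calc _ ≤ 2 * W * ((δ / (16 * c)) ^ (1 / γ) / (2 * W)) := by
          gcongr; exact min_le_right _ _
      _ = _ := by field_simp
  calc c * (2 * W * spreadFactor c γ δ W) ^ γ ≤ c * ((δ / (16 * c)) ^ (1 / γ)) ^ γ := by
        have := h.spreadFactor_pos
        gcongr
    _ = δ / 16 := by
        rw [← Real.rpow_mul (by positivity), one_div_mul_cancel hγ.ne', Real.rpow_one]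
        field_simp

/-- The connecting paths stay inside the subgraph domain. -/
lemma connectingPath_mem (h : IsHolderSubgraph c γ δ W s t f) {x z : Fin (n + 1) → ℝ}
    (hx : x ∈ subgraphDomain W s t f) (hz : z ∈ referenceBox n W s (δ / 8)) {τ : ℝ}
    (hτ : τ ∈ Icc (0 : ℝ) 1) :
    connectingPath γ (spreadFactor c γ δ W) x z τ ∈ subgraphDomain W s t f := by
  have hc := h.hc; have hδ := h.hδ.1; have hW := h.hW; have hγ := h.hγ.1
  have hτ0 := hτ.1; have hτ1 := hτ.2
  set κ := spreadFactor c γ δ W with hκ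
  have hκ0 : 0 < κ := h.spreadFactor_pos
  have hκ1 : κ ≤ 1 := min_le_left _ _
  obtain ⟨hθ0, hθ1⟩ := horizontalProfile_mem_Icc (γ := γ) h.hγ.1 hκ0.le hκ1 hτ
  set y := connectingPath γ κ x z τ with hy
  have hyc : ∀ i : Fin n, y i.castSucc = x i.castSucc +
      horizontalProfile γ κ τ * (z i.castSucc - x i.castSucc) := fun i => by
    simp [hy, connectingPath]
  have hyl : y (Fin.last n) = x (Fin.last n) + τ * (z (Fin.last n) - x (Fin.last n)) := by
    simp [hy, connectingPath]
  have hzc : ∀ i : Fin n, z i.castSucc ∈ Ioo (-W) W := fun i => by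
    simpa using hz i.castSucc (mem_univ _)
  have hzl : z (Fin.last n) ∈ Ioo s (δ / 8) := by simpa using hz (Fin.last n) (mem_univ _)
  have hxl := hx.2.1
  have hycube : ∀ i : Fin n, y i.castSucc ∈ Ioo (-W) W := fun i => by
    have := (convex_Ioo (-W) W).add_smul_sub_mem (hx.1 i) (hzc i) ⟨hθ0, hθ1⟩
    rw [hyc]; simpa using this
  have hylow : s < y (Fin.last n) := by
    have := (convex_Ioi s).add_smul_sub_mem (show x (Fin.last n) ∈ Ioi s from hxl)
      (show z (Fin.last n) ∈ Ioi s from hzl.1) hτ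
    rw [hyl]; simpa using this
  have hfy := h.bounds (Fin.init y) hycube
  have hfx := h.bounds (Fin.init x) hx.1
  have hxδ : x (Fin.last n) < δ := by linarith [hx.2.2, hfx.2, h.ht.1]
  refine ⟨hycube, hylow, ?_⟩
  rcases lt_or_ge (y (Fin.last n)) (3 * δ / 16) with hlt | hge
  · linarith [hfy.1, h.ht.2]
  · -- The path has not yet come down to the level `3 δ / 16`, so `τ ≤ 13/14`, and it has
    -- descended by at least `τ δ / 16`, which exceeds the possible decrease of `f`.
    have hxz : δ / 16 ≤ x (Fin.last n) - z (Fin.last n) := by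
      have : 3 * δ / 16 ≤ x (Fin.last n) := by
        by_contra hcon
        push Not at hcon
        have := (convex_Iio (3 * δ / 16)).add_smul_sub_mem (mem_Iio.2 hcon)
          (mem_Iio.2 (by linarith [hzl.2] : z (Fin.last n) < 3 * δ / 16)) hτ
        simp only [smul_eq_mul, mem_Iio] at this
        linarith
      linarith [hzl.2]
    have hτ' : τ ≤ 13 / 14 := by
      by_contra hcon
      push Not at hcon
      have : x (Fin.last n) + τ * (z (Fin.last n) - x (Fin.last n)) < 3 * δ / 16 := by
        nlinarith [hzl.2]
      linarith
    have hdist : ‖Fin.init x - Fin.init y‖ ≤ 2 * W * κ * τ ^ (1 / γ) := by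
      rw [pi_norm_le_iff_of_nonneg (by positivity)]
      intro i
      have e : (Fin.init x - Fin.init y) i =
          horizontalProfile γ κ τ * (x i.castSucc - z i.castSucc) := by
        simp only [Pi.sub_apply, Fin.init, hyc]; ring
      rw [e, horizontalProfile_eq_of_le hτ', norm_mul,
        Real.norm_of_nonneg (by positivity)]
      have : ‖x i.castSucc - z i.castSucc‖ ≤ 2 * W := by
        rw [Real.norm_eq_abs, abs_le]
        constructor <;> linarith [(hx.1 i).1, (hx.1 i).2, (hzc i).1, (hzc i).2]
      calc κ * τ ^ (1 / γ) * ‖x i.castSucc - z i.castSucc‖ ≤ κ * τ ^ (1 / γ) * (2 * W) := by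
            gcongr
        _ = _ := by ring
    have hdrop : |f (Fin.init x) - f (Fin.init y)| ≤ δ / 16 * τ := by
      calc _ ≤ c * ‖Fin.init x - Fin.init y‖ ^ γ := h.holder _ hx.1 _ hycube
        _ ≤ c * (2 * W * κ * τ ^ (1 / γ)) ^ γ := by gcongr
        _ = c * (2 * W * κ) ^ γ * τ := by
            rw [Real.mul_rpow (by positivity) (by positivity), ← Real.rpow_mul hτ0,
              one_div_mul_cancel hγ.ne', Real.rpow_one]
            ring
        _ ≤ _ := by gcongr; exact h.mul_spreadFactor_rpow_le
    have := (abs_le.1 hdrop).2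
    nlinarith [hx.2.2]

lemma isOpen_subgraphDomain (h : IsHolderSubgraph c γ δ W s t f) :
    IsOpen (subgraphDomain W s t f) := by
  have hγ := h.hγ.1
  set Q : Set (Fin n → ℝ) := univ.pi fun _ => Ioo (-W) W
  have hQ : IsOpen Q := isOpen_set_pi finite_univ fun _ _ => isOpen_Ioo
  have hf : ContinuousOn f Q := by
    intro x' hx'
    rw [ContinuousWithinAt, tendsto_iff_dist_tendsto_zero]
    have hlim : Filter.Tendsto (fun y' => c * ‖y' - x'‖ ^ γ) (nhdsWithin x' Q) (nhds 0) := by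
      have : Continuous fun y' : Fin n → ℝ => c * ‖y' - x'‖ ^ γ :=
        continuous_const.mul ((continuous_id.sub continuous_const).norm.rpow_const
          fun _ => Or.inr hγ.le)
      have h2 := this.tendsto x'
      simp only [sub_self, norm_zero, Real.zero_rpow hγ.ne', mul_zero] at h2
      exact h2.mono_left nhdsWithin_le_nhds
    refine squeeze_zero' (Filter.Eventually.of_forall fun _ => dist_nonneg) ?_ hlim
    filter_upwards [self_mem_nhdsWithin] with y' hy'
    exact h.holder y' (fun i => hy' i (mem_univ _)) x' fun i => hx' i (mem_univ _)
  have hinit : Continuous fun x : Fin (n + 1) → ℝ => (Fin.init x : Fin n → ℝ) :=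
    continuous_pi fun i => continuous_apply _
  set U : Set (Fin (n + 1) → ℝ) := {x | Fin.init x ∈ Q}
  have hU : IsOpen U := hQ.preimage hinit
  have hcont : ContinuousOn (fun x : Fin (n + 1) → ℝ => f (Fin.init x) - t - x (Fin.last n)) U :=
    ((hf.comp hinit.continuousOn fun x hx => hx).sub continuousOn_const).sub
      (continuous_apply _).continuousOn
  have h1 := hcont.isOpen_inter_preimage hU (isOpen_Ioi (a := (0 : ℝ)))
  have h2 : IsOpen {x : Fin (n + 1) → ℝ | s < x (Fin.last n)} :=
    isOpen_lt continuous_const (continuous_apply _)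
  convert! h1.inter h2 using 1
  ext x
  simp only [subgraphDomain, U, Q, mem_ofPred_eq, mem_inter_iff, mem_preimage, mem_Ioi, Set.mem_pi,
    mem_univ, true_implies, sub_pos, Fin.init]
  tauto

end IsHolderSubgraph

/-! ### Pointwise bounds by averages of the gradient -/

/-- The change of variables `y = p * (z - x)` with a coordinatewise product. -/
lemma lintegral_comp_mul_sub_le {ι : Type*} [Fintype ι] {p : ι → ℝ} (hp : ∀ i, 0 < p i)
    (x : ι → ℝ) {B E : Set (ι → ℝ)} (hB : MeasurableSet B) (hE : MeasurableSet E)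
    (hBE : ∀ z ∈ B, p * (z - x) ∈ E) {H : (ι → ℝ) → ℝ≥0∞} (hH : Measurable H) :
    ∫⁻ z in B, H (x + p * (z - x)) ≤
      (ENNReal.ofReal (∏ i, p i))⁻¹ * ∫⁻ y in E, H (x + y) := by
  classical
  have hP : 0 < ∏ i, p i := Finset.prod_pos fun i _ => hp i
  set Φ : (ι → ℝ) → ℝ≥0∞ := E.indicator fun y => H (x + y) with hΦ
  have hΦm : Measurable Φ := Measurable.indicator (by fun_prop) hE
  have hdet : (Matrix.diagonal p).det ≠ 0 := by rw [Matrix.det_diagonal]; exact hP.ne'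
  have hmap := Real.smul_map_diagonal_volume_pi hdet
  rw [Matrix.det_diagonal, abs_of_pos hP] at hmap
  have hlin : ∀ z, Matrix.toLin' (Matrix.diagonal p) z = p * z := fun z => by
    ext i; simp [Matrix.mulVec_diagonal]
  have hmeas : Measurable (Matrix.toLin' (Matrix.diagonal p)) :=
    (LinearMap.continuous_of_finiteDimensional _).measurable
  have h1 : ∫⁻ y in E, H (x + y) = ENNReal.ofReal (∏ i, p i) * ∫⁻ z, Φ (p * z) := by
    rw [← lintegral_indicator hE]
    change ∫⁻ y, Φ y = _
    conv_lhs => rw [← hmap]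
    rw [lintegral_smul_measure, lintegral_map hΦm hmeas]
    simp only [hlin, smul_eq_mul]
  rw [h1, ← mul_assoc, ENNReal.inv_mul_cancel (ENNReal.ofReal_pos.2 hP).ne' ENNReal.ofReal_ne_top,
    one_mul, ← lintegral_sub_right_eq_self (fun z => Φ (p * z)) x, ← lintegral_indicator hB]
  refine lintegral_mono fun z => ?_
  by_cases hz : z ∈ B
  · rw [indicator_of_mem hz, hΦ, indicator_of_mem (hBE z hz)]
  · rw [indicator_of_notMem hz]; exact zero_le

/-- The symmetric boxes over which the gradient is averaged: at time `τ`, a connecting path that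
starts at `x` lies in the translate by `x` of this box. -/
noncomputable def averagingBox (n : ℕ) (γ κ δ W τ : ℝ) : Set (Fin (n + 1) → ℝ) :=
  Icc (-(horizVert (2 * W * horizontalProfile γ κ τ) (δ * τ)))
    (horizVert (2 * W * horizontalProfile γ κ τ) (δ * τ))

lemma continuous_horizVert {n : ℕ} {X : Type*} [TopologicalSpace X] {a b : X → ℝ}
    (ha : Continuous a) (hb : Continuous b) :
    Continuous fun t => (horizVert (a t) (b t) : Fin (n + 1) → ℝ) := by
  refine continuous_pi fun i => ?_
  induction i using Fin.lastCases <;> simpa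

lemma measurableSet_averagingBox (n : ℕ) {γ κ δ W : ℝ} (hγ : 0 < γ) :
    MeasurableSet {p : ℝ × (Fin (n + 1) → ℝ) | p.2 ∈ averagingBox n γ κ δ W p.1} := by
  have hc := continuous_horizontalProfile (κ := κ) hγ
  have hh : Continuous fun p : ℝ × (Fin (n + 1) → ℝ) =>
      (horizVert (2 * W * horizontalProfile γ κ p.1) (δ * p.1) : Fin (n + 1) → ℝ) :=
    continuous_horizVert (by fun_prop) (by fun_prop)
  exact ((isClosed_le hh.neg continuous_snd).inter
    (isClosed_le continuous_snd hh)).measurableSet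

lemma volume_averagingBox (n : ℕ) {γ κ δ W τ : ℝ} (hW : 0 ≤ W)
    (hθ : 0 ≤ horizontalProfile γ κ τ) :
    volume (averagingBox n γ κ δ W τ) =
      ENNReal.ofReal ((4 * W * horizontalProfile γ κ τ) ^ n * (2 * δ * τ)) := by
  rw [averagingBox, Real.volume_Icc_pi, Fin.prod_univ_castSucc]
  simp only [Pi.neg_apply, horizVert_castSucc, horizVert_last, Finset.prod_const,
    Finset.card_univ, Fintype.card_fin]
  rw [← ENNReal.ofReal_pow (by nlinarith), ← ENNReal.ofReal_mul (pow_nonneg (by nlinarith) _)]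
  congr 1; ring

lemma volume_referenceBox (n : ℕ) {W s h : ℝ} (hW : 0 ≤ W) :
    volume (referenceBox n W s h) = ENNReal.ofReal ((2 * W) ^ n * (h - s)) := by
  rw [referenceBox, Real.volume_pi_Ioo, Fin.prod_univ_castSucc]
  simp only [horizVert_castSucc, horizVert_last, Finset.prod_const,
    Finset.card_univ, Fintype.card_fin]
  rw [← ENNReal.ofReal_pow (by linarith), ← ENNReal.ofReal_mul (pow_nonneg (by linarith) _)]
  congr 2; ring

lemma measurableSet_referenceBox (n : ℕ) (W s h : ℝ) : MeasurableSet (referenceBox n W s h) :=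
  MeasurableSet.univ_pi fun _ => measurableSet_Ioo

lemma continuous_connectingPath {n : ℕ} {γ κ : ℝ} (hγ : 0 < γ) (x : Fin (n + 1) → ℝ) :
    Continuous fun p : (Fin (n + 1) → ℝ) × ℝ => connectingPath γ κ x p.1 p.2 := by
  have hc := continuous_horizontalProfile (κ := κ) hγ
  have hh : Continuous fun p : (Fin (n + 1) → ℝ) × ℝ =>
      (horizVert (horizontalProfile γ κ p.2) p.2 : Fin (n + 1) → ℝ) :=
    continuous_horizVert (by fun_prop) (by fun_prop)
  unfold connectingPath
  fun_prop

namespace IsHolderSubgraph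

variable {n : ℕ} {c γ δ W s t : ℝ} {f : (Fin n → ℝ) → ℝ}

lemma abs_sub_le (h : IsHolderSubgraph c γ δ W s t f) {x z : Fin (n + 1) → ℝ}
    (hx : x ∈ subgraphDomain W s t f) (hz : z ∈ referenceBox n W s (δ / 8)) :
    (∀ i : Fin n, |z i.castSucc - x i.castSucc| ≤ 2 * W) ∧
      |z (Fin.last n) - x (Fin.last n)| ≤ δ := by
  have hzl : z (Fin.last n) ∈ Ioo s (δ / 8) := by simpa using hz (Fin.last n) (mem_univ _)
  have hfx := h.bounds (Fin.init x) hx.1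
  have hδ := h.hδ.1
  refine ⟨fun i => ?_, ?_⟩
  · have hzc : z i.castSucc ∈ Ioo (-W) W := by simpa using hz i.castSucc (mem_univ _)
    rw [abs_le]
    constructor <;> linarith [(hx.1 i).1, (hx.1 i).2, hzc.1, hzc.2]
  · rw [abs_le]
    constructor <;> linarith [hx.2.1, hx.2.2, hfx.2, h.ht.1, h.hs.1, hzl.1, hzl.2]

/-- The fundamental theorem of calculus along a connecting path. -/
lemma enorm_sub_le (h : IsHolderSubgraph c γ δ W s t f) {v : (Fin (n + 1) → ℝ) → ℂ}
    (hv : ContDiff ℝ 1 v) {x z : Fin (n + 1) → ℝ} (hx : x ∈ subgraphDomain W s t f)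
    (hz : z ∈ referenceBox n W s (δ / 8)) :
    ‖v x - v z‖ₑ ≤ ENNReal.ofReal ((1 / γ + 28) * δ) * ∫⁻ τ in Ioo (0 : ℝ) 1,
      (subgraphDomain W s t f).indicator (fun y => ‖fderiv ℝ v y‖ₑ)
        (connectingPath γ (spreadFactor c γ δ W) x z τ) := by
  have hγ0 := h.hγ.1
  have hδ := h.hδ.1
  set κ := spreadFactor c γ δ W with hκ
  have hκ0 : 0 < κ := h.spreadFactor_pos
  have hκ1 : κ ≤ 1 := min_le_left _ _
  set P : ℝ → Fin (n + 1) → ℝ := connectingPath γ κ x z with hP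
  set P' : ℝ → Fin (n + 1) → ℝ := fun τ => horizVert (horizontalProfileDeriv γ κ τ) 1 * (z - x)
    with hP'
  have hPd : ∀ τ, HasDerivAt P (P' τ) τ := by
    intro τ
    rw [hasDerivAt_pi]
    intro i
    induction i using Fin.lastCases with
    | last =>
      simpa [hP, hP', connectingPath] using
        ((hasDerivAt_id τ).mul_const (z (Fin.last n) - x (Fin.last n))).const_add (x (Fin.last n))
    | cast i =>
      simpa [hP, hP', connectingPath] using
        ((hasDerivAt_horizontalProfile h.hγ τ).mul_const
          (z i.castSucc - x i.castSucc)).const_add (x i.castSucc)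
  have hPc : Continuous P := continuous_iff_continuousAt.2 fun τ => (hPd τ).continuousAt
  have hP'c : Continuous P' :=
    (continuous_horizVert (continuous_horizontalProfileDeriv h.hγ) continuous_const).mul
      continuous_const
  have hvP : ∀ τ, HasDerivAt (fun τ => v (P τ)) (fderiv ℝ v (P τ) (P' τ)) τ := fun τ =>
    ((hv.differentiable one_ne_zero) (P τ)).hasFDerivAt.comp_hasDerivAt τ (hPd τ)
  have hint : Continuous fun τ => fderiv ℝ v (P τ) (P' τ) :=
    ((hv.continuous_fderiv one_ne_zero).comp hPc).clm_apply hP'c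
  have hftc := intervalIntegral.integral_eq_sub_of_hasDerivAt (a := 0) (b := 1)
    (fun τ _ => hvP τ) (hint.intervalIntegrable _ _)
  have hP0 : P 0 = x := by
    ext i
    induction i using Fin.lastCases <;> simp [hP, connectingPath, horizontalProfile_zero hγ0]
  have hP1 : P 1 = z := by
    ext i
    induction i using Fin.lastCases <;> simp [hP, connectingPath, horizontalProfile_one]
  rw [hP0, hP1] at hftc
  rw [← enorm_neg, neg_sub, ← hftc, intervalIntegral.integral_of_le zero_le_one,
    ← lintegral_const_mul' _ _ ENNReal.ofReal_ne_top, integral_Ioc_eq_integral_Ioo]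
  refine (enorm_integral_le_lintegral_enorm _).trans
    (setLIntegral_mono' measurableSet_Ioo fun τ hτ => ?_)
  have hτ' : τ ∈ Icc (0 : ℝ) 1 := Ioo_subset_Icc_self hτ
  rw [indicator_of_mem (h.connectingPath_mem hx hz hτ')]
  have hspeed : ‖P' τ‖ ≤ (1 / γ + 28) * δ := by
    have hL : 0 < 1 / γ + 28 := by positivity
    rw [pi_norm_le_iff_of_nonneg (by positivity)]
    obtain ⟨hc, hl⟩ := h.abs_sub_le hx hz
    intro i
    induction i using Fin.lastCases with
    | last =>
      simp only [hP', Pi.mul_apply, Pi.sub_apply, horizVert_last, one_mul, Real.norm_eq_abs]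
      have : 0 < 1 / γ := by positivity
      nlinarith
    | cast i =>
      simp only [hP', Pi.mul_apply, Pi.sub_apply, horizVert_castSucc, Real.norm_eq_abs, abs_mul]
      have := abs_horizontalProfileDeriv_le h.hγ hκ0.le hκ1 hτ'
      gcongr
      exact (hc i).trans h.hWδ
  rw [mul_comm, ← ofReal_norm, ← ofReal_norm,
    ← ENNReal.ofReal_mul (norm_nonneg _)]
  refine ENNReal.ofReal_le_ofReal ?_
  calc _ ≤ ‖fderiv ℝ v (P τ)‖ * ‖P' τ‖ := ContinuousLinearMap.le_opNorm _ _
    _ ≤ _ := by gcongr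

/-- At time `τ`, averaging over the endpoint `z` of the path amounts to averaging over a
translated box. -/
lemma inv_volume_mul_lintegral_le (h : IsHolderSubgraph c γ δ W s t f)
    {H : (Fin (n + 1) → ℝ) → ℝ≥0∞} (hH : Measurable H) {x : Fin (n + 1) → ℝ}
    (hx : x ∈ subgraphDomain W s t f) {τ : ℝ} (hτ : τ ∈ Ioo (0 : ℝ) 1) :
    (volume (referenceBox n W s (δ / 8)))⁻¹ * ∫⁻ z in referenceBox n W s (δ / 8),
        H (connectingPath γ (spreadFactor c γ δ W) x z τ) ≤
      ENNReal.ofReal (32 * 2 ^ n) * translateAverage volume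
        (averagingBox n γ (spreadFactor c γ δ W) δ W) H τ x := by
  have hδ := h.hδ.1
  have hW := h.hW
  have hτ0 := hτ.1
  set κ := spreadFactor c γ δ W with hκ
  have hκ0 : 0 < κ := h.spreadFactor_pos
  have hκ1 : κ ≤ 1 := min_le_left _ _
  set θ := horizontalProfile γ κ τ with hθ
  have hθ0 : 0 < θ :=
    lt_of_lt_of_le (by positivity) (mul_rpow_le_horizontalProfile (γ := γ) hκ1 τ)
  have hs : 0 < δ / 8 - s := by linarith [h.hs.2]
  have hcv := lintegral_comp_mul_sub_le (horizVert_pos (n := n) hθ0 hτ0) x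
    (measurableSet_referenceBox n W s (δ / 8))
    (E := averagingBox n γ κ δ W τ) measurableSet_Icc (fun z hz => by
      obtain ⟨hc, hl⟩ := h.abs_sub_le hx hz
      rw [averagingBox, ← hθ]
      have habs : ∀ i, |(horizVert θ τ * (z - x) : Fin (n + 1) → ℝ) i| ≤
          horizVert (2 * W * θ) (δ * τ) i := by
        intro i
        induction i using Fin.lastCases with
        | last =>
          simp only [Pi.mul_apply, Pi.sub_apply, horizVert_last, abs_mul, abs_of_pos hτ0]
          nlinarith
        | cast i =>
          simp only [Pi.mul_apply, Pi.sub_apply, horizVert_castSucc, abs_mul, abs_of_pos hθ0]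
          nlinarith [hc i]
      exact ⟨fun i => (abs_le.1 (habs i)).1, fun i => (abs_le.1 (habs i)).2⟩) hH
  rw [prod_horizVert] at hcv
  rw [translateAverage, volume_averagingBox n hW.le hθ0.le, volume_referenceBox n hW.le, ← hθ]
  calc _ ≤ (ENNReal.ofReal ((2 * W) ^ n * (δ / 8 - s)))⁻¹ * ((ENNReal.ofReal (θ ^ n * τ))⁻¹ *
        ∫⁻ y in averagingBox n γ κ δ W τ, H (x + y)) := by gcongr; exact hcv
    _ ≤ _ := by
        rw [← mul_assoc, ← mul_assoc]
        gcongr ?_ * _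
        rw [← ENNReal.ofReal_inv_of_pos (by positivity),
          ← ENNReal.ofReal_inv_of_pos (by positivity),
          ← ENNReal.ofReal_inv_of_pos (by positivity), ← ENNReal.ofReal_mul (by positivity),
          ← ENNReal.ofReal_mul (by positivity)]
        refine ENNReal.ofReal_le_ofReal ?_
        rw [← mul_inv, ← div_eq_mul_inv, inv_le_iff_one_le_mul₀ (by positivity),
          ← mul_div_right_comm,
          one_le_div (by positivity)]
        have hs' : δ / 16 ≤ δ / 8 - s := by linarith [h.hs.2]
        calc (4 * W * θ) ^ n * (2 * δ * τ)
            = 32 * 2 ^ n * ((2 * W) ^ n * (δ / 16) * (θ ^ n * τ)) := by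
              rw [show 4 * W * θ = 2 * (2 * W) * θ by ring, mul_pow, mul_pow]; ring
          _ ≤ _ := by gcongr

/-- The deviation of `v` from its mean over the reference box is controlled pointwise by
averages of the gradient over boxes of all scales. -/
lemma enorm_sub_average_le (h : IsHolderSubgraph c γ δ W s t f) {v : (Fin (n + 1) → ℝ) → ℂ}
    (hv : ContDiff ℝ 1 v) {x : Fin (n + 1) → ℝ} (hx : x ∈ subgraphDomain W s t f) :
    ‖v x - ⨍ z in referenceBox n W s (δ / 8), v z‖ₑ ≤
      ENNReal.ofReal ((1 / γ + 28) * δ * (32 * 2 ^ n)) *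
        ∫⁻ τ in Ioo (0 : ℝ) 1, translateAverage volume
          (averagingBox n γ (spreadFactor c γ δ W) δ W)
          ((subgraphDomain W s t f).indicator (fun y => ‖fderiv ℝ v y‖ₑ)) τ x := by
  have hγ0 := h.hγ.1
  have hδ := h.hδ.1
  set κ := spreadFactor c γ δ W with hκ
  set B := referenceBox n W s (δ / 8) with hB
  set H := (subgraphDomain W s t f).indicator (fun y => ‖fderiv ℝ v y‖ₑ) with hH
  have hHm : Measurable H :=
    (hv.continuous_fderiv one_ne_zero).enorm.measurable.indicator
      h.isOpen_subgraphDomain.measurableSet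
  have hvol : volume B = ENNReal.ofReal ((2 * W) ^ n * (δ / 8 - s)) :=
    volume_referenceBox n h.hW.le
  have hB0 : volume B ≠ 0 := by
    rw [hvol]
    have := h.hW
    have : 0 < δ / 8 - s := by linarith [h.hs.2]
    exact (ENNReal.ofReal_pos.2 (by positivity)).ne'
  have hBt : volume B ≠ ⊤ := by rw [hvol]; exact ENNReal.ofReal_ne_top
  have hBm : MeasurableSet B := measurableSet_referenceBox _ _ _ _
  have hvi : IntegrableOn v B := by
    refine (hv.continuous.continuousOn.integrableOn_compact
      (isCompact_univ_pi fun i => isCompact_Icc)).mono_set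
      (t := univ.pi fun i => Icc (horizVert (-W) s i) (horizVert W (δ / 8) i)) ?_
    exact pi_mono fun i _ => Ioo_subset_Icc_self
  have : IsProbabilityMeasure ((volume B)⁻¹ • volume.restrict B) :=
    ⟨by simp [ENNReal.inv_mul_cancel hB0 hBt]⟩
  have hvi' : Integrable v ((volume B)⁻¹ • volume.restrict B) :=
    hvi.smul_measure (ENNReal.inv_ne_top.2 hB0)
  have hconst : v x - ⨍ z in B, v z = ∫ z, (v x - v z) ∂((volume B)⁻¹ • volume.restrict B) := by
    rw [integral_sub (integrable_const _) hvi', integral_const, probReal_univ, one_smul]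
    rw [average, Measure.restrict_apply_univ]
  have hpm : Measurable fun p : (Fin (n + 1) → ℝ) × ℝ => H (connectingPath γ κ x p.1 p.2) :=
    hHm.comp (continuous_connectingPath hγ0 x).measurable
  calc ‖v x - ⨍ z in B, v z‖ₑ ≤ ∫⁻ z, ‖v x - v z‖ₑ ∂((volume B)⁻¹ • volume.restrict B) := by
        rw [hconst]; exact enorm_integral_le_lintegral_enorm _
    _ = (volume B)⁻¹ * ∫⁻ z in B, ‖v x - v z‖ₑ := by rw [lintegral_smul_measure, smul_eq_mul]
    _ ≤ (volume B)⁻¹ * ∫⁻ z in B, ENNReal.ofReal ((1 / γ + 28) * δ) *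
          ∫⁻ τ in Ioo (0 : ℝ) 1, H (connectingPath γ κ x z τ) := by
        refine mul_le_mul_right ?_ _
        exact setLIntegral_mono' hBm fun z hz => h.enorm_sub_le hv hx hz
    _ = ENNReal.ofReal ((1 / γ + 28) * δ) * ∫⁻ τ in Ioo (0 : ℝ) 1,
          (volume B)⁻¹ * ∫⁻ z in B, H (connectingPath γ κ x z τ) := by
        rw [lintegral_const_mul' _ _ ENNReal.ofReal_ne_top, mul_left_comm,
          lintegral_lintegral_swap hpm.aemeasurable,
          lintegral_const_mul' _ _ (ENNReal.inv_ne_top.2 hB0)]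
    _ ≤ ENNReal.ofReal ((1 / γ + 28) * δ) * ∫⁻ τ in Ioo (0 : ℝ) 1, ENNReal.ofReal (32 * 2 ^ n) *
          translateAverage volume (averagingBox n γ κ δ W) H τ x := by
        refine mul_le_mul_right ?_ _
        exact setLIntegral_mono' measurableSet_Ioo fun τ hτ =>
          h.inv_volume_mul_lintegral_le hHm hx hτ
    _ = _ := by
        rw [lintegral_const_mul' _ _ ENNReal.ofReal_ne_top, ← mul_assoc,
          ← ENNReal.ofReal_mul (by positivity)]

end IsHolderSubgraph

/-! ### The Poincaré–Sobolev inequality for `C¹` functions -/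

namespace IsHolderSubgraph

variable {n : ℕ} {c γ δ W s t : ℝ} {f : (Fin n → ℝ) → ℝ}

/-- The averaging boxes have the effective dimension `n / γ + 1`. -/
lemma le_volume_averagingBox (h : IsHolderSubgraph c γ δ W s t f) {τ : ℝ}
    (hτ : τ ∈ Ioo (0 : ℝ) 1) :
    ENNReal.ofReal ((4 * W * spreadFactor c γ δ W) ^ n * (2 * δ) * τ ^ (n / γ + 1)) ≤
      volume (averagingBox n γ (spreadFactor c γ δ W) δ W τ) := by
  have hδ := h.hδ.1
  have hW := h.hW
  have hτ0 := hτ.1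
  set κ := spreadFactor c γ δ W with hκ
  have hκ0 : 0 < κ := h.spreadFactor_pos
  have hκ1 : κ ≤ 1 := min_le_left _ _
  have hle := mul_rpow_le_horizontalProfile (γ := γ) hκ1 τ
  rw [volume_averagingBox n hW.le (le_trans (by positivity) hle)]
  refine ENNReal.ofReal_le_ofReal ?_
  calc (4 * W * κ) ^ n * (2 * δ) * τ ^ (n / γ + 1)
      = (4 * W * (κ * τ ^ (1 / γ))) ^ n * (2 * δ * τ) := by
        rw [Real.rpow_add hτ0, Real.rpow_one, show (n : ℝ) / γ = 1 / γ * n by ring,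
          Real.rpow_mul hτ0.le, Real.rpow_natCast]
        ring
    _ ≤ _ := by gcongr

/-- The coefficient of `τ ^ (n / γ + 1)` in the lower bound for the volumes of the averaging boxes,
compared with the scale `δ`; this is where the width of the base, at least `δ / (2 M)`, enters. -/
lemma rpow_le_mul_volume (h : IsHolderSubgraph c γ δ W s t f) {M : ℝ} (hM : 1 ≤ M)
    (hMW : δ ≤ 4 * M * W) :
    δ ^ (n / γ + 1) ≤ (1 + (16 * c) ^ (n / γ)) * M ^ n *
      ((4 * W * spreadFactor c γ δ W) ^ n * (2 * δ)) := by
  have hδ := h.hδ.1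
  have hδ1 := h.hδ.2
  have hW := h.hW
  have hc := h.hc
  have hγ0 := h.hγ.1
  have hM0 : 0 < M := by linarith
  have hκ : 0 < spreadFactor c γ δ W := h.spreadFactor_pos
  have hnγ : (n : ℝ) ≤ n / γ := by
    rw [le_div_iff₀ hγ0]
    have : (0 : ℝ) ≤ n := by positivity
    nlinarith [h.hγ.2]
  have hC : 0 < (16 * c) ^ (n / γ) := by positivity
  have hsplit : δ ^ (n / γ + 1) = δ ^ (n / γ) * δ := by
    rw [Real.rpow_add hδ, Real.rpow_one]
  rw [hsplit]
  suffices hmain : δ ^ (n / γ) ≤ (1 + (16 * c) ^ (n / γ)) * (M ^ n *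
      (4 * W * spreadFactor c γ δ W) ^ n) by
    calc δ ^ (n / γ) * δ ≤ (1 + (16 * c) ^ (n / γ)) * (M ^ n *
          (4 * W * spreadFactor c γ δ W) ^ n) * (2 * δ) := by
          gcongr
          linarith
      _ = _ := by ring
  rcases min_choice 1 ((δ / (16 * c)) ^ (1 / γ) / (2 * W)) with hmin | hmin
  · have e : spreadFactor c γ δ W = 1 := hmin
    rw [e, mul_one, ← mul_pow]
    calc δ ^ (n / γ) ≤ δ ^ (n : ℝ) := Real.rpow_le_rpow_of_exponent_ge hδ hδ1.le hnγ
      _ = δ ^ n := Real.rpow_natCast _ _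
      _ ≤ (M * (4 * W)) ^ n := by
          gcongr
          linarith
      _ ≤ _ := le_mul_of_one_le_left (by positivity) (by linarith)
  · have e : spreadFactor c γ δ W = (δ / (16 * c)) ^ (1 / γ) / (2 * W) := hmin
    have e2 : 4 * W * spreadFactor c γ δ W = 2 * (δ / (16 * c)) ^ (1 / γ) := by
      rw [e]; field_simp; norm_num
    have e3 : ((δ / (16 * c)) ^ (1 / γ)) ^ n = δ ^ (n / γ) / (16 * c) ^ (n / γ) := by
      rw [← Real.rpow_natCast, ← Real.rpow_mul (by positivity), one_div_mul_eq_div,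
        Real.div_rpow hδ.le (by positivity)]
    rw [e2, mul_pow, e3]
    calc δ ^ (n / γ) = (16 * c) ^ (n / γ) * (1 * (1 * (δ ^ (n / γ) / (16 * c) ^ (n / γ)))) := by
          field_simp
      _ ≤ _ := by
          gcongr
          · linarith
          · exact one_le_pow₀ hM
          · exact one_le_pow₀ (by norm_num)

end IsHolderSubgraph

lemma ENNReal.ofReal_rpow_eq_enorm_rpow {E : Type*} [SeminormedAddGroup E] (y : E) {q : ℝ}
    (hq : 0 ≤ q) : ENNReal.ofReal (‖y‖ ^ q) = ‖y‖ₑ ^ q := by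
  rw [← ofReal_norm, ENNReal.ofReal_rpow_of_nonneg (norm_nonneg _) hq]

/-- The Poincaré–Sobolev inequality for `C¹` functions, uniformly over the class of subgraph
domains. -/
theorem exists_eLpNorm_sub_average_le_of_contDiff {n : ℕ} (hn : 1 ≤ n) {c γ : ℝ} (hc : 0 < c)
    (hγ : γ ∈ Ioo (0 : ℝ) 1) {D q : ℝ} (hD : D = n / γ + 1) (hq : q = 2 * D / (D - 2)) :
    ∃ K : ℝ, 0 < K ∧ ∀ (M δ W s t : ℝ) (f : (Fin n → ℝ) → ℝ), 1 ≤ M →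
      IsHolderSubgraph c γ δ W s t f → δ ≤ 4 * M * W →
      ∀ v : (Fin (n + 1) → ℝ) → ℂ, ContDiff ℝ 1 v →
        eLpNorm (fun x => v x - ⨍ z in referenceBox n W s (δ / 8), v z) (ENNReal.ofReal q)
            (volume.restrict (subgraphDomain W s t f)) ≤
          ENNReal.ofReal (K * M ^ (n / D)) *
            eLpNorm (fderiv ℝ v) 2 (volume.restrict (subgraphDomain W s t f)) := by
  have hγ0 := hγ.1
  have hn' : (1 : ℝ) ≤ n := by exact_mod_cast hn
  have hD2 : 2 < D := by
    have : 1 < n / γ := by rw [lt_div_iff₀ hγ0]; linarith [hγ.2]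
    linarith
  have hD0 : 0 < D - 2 := by linarith
  have hq0 : 0 < q := by rw [hq]; positivity
  set C₀ : ℝ := 32 * (4 / (D - 2)) ^ (4 / (D - 2)) with hC₀
  have hC₀0 : 0 < C₀ := by positivity
  set C₁ : ℝ := 1 + (16 * c) ^ (n / γ) with hC₁
  have hC₁0 : 0 < C₁ := by positivity
  set C₂ : ℝ := (1 / γ + 28) * (32 * 2 ^ n) with hC₂
  have hC₂0 : 0 < C₂ := by positivity
  refine ⟨C₂ * C₀ ^ (1 / q) * C₁ ^ (1 / D), by positivity, ?_⟩
  intro M δ W s t f hM h hMW v hv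
  have hδ := h.hδ.1
  have hM0 : 0 < M := by linarith
  set S := subgraphDomain W s t f with hS
  have hSm : MeasurableSet S := h.isOpen_subgraphDomain.measurableSet
  set κ := spreadFactor c γ δ W with hκ
  have hκ0 : 0 < κ := h.spreadFactor_pos
  set a : ℝ := (4 * W * κ) ^ n * (2 * δ) with ha
  have ha0 : 0 < a := by have := h.hW; positivity
  set m : ℂ := ⨍ z in referenceBox n W s (δ / 8), v z with hm
  set G : (Fin (n + 1) → ℝ) → ℝ≥0∞ := S.indicator fun y => ‖fderiv ℝ v y‖ₑ with hG
  have hGm : Measurable G :=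
    (hv.continuous_fderiv one_ne_zero).enorm.measurable.indicator hSm
  have hGfin : ∀ x, G x ≠ ⊤ := fun x => by
    by_cases hx : x ∈ S
    · rw [hG, indicator_of_mem hx]; exact enorm_ne_top
    · rw [hG, indicator_of_notMem hx]; exact ENNReal.zero_ne_top
  set F : (Fin (n + 1) → ℝ) → ℝ := S.indicator fun x => ‖v x - m‖ / (C₂ * δ) with hF
  have hFm : Measurable F :=
    ((hv.continuous.sub continuous_const).norm.div_const _).measurable.indicator hSm
  have hF0 : ∀ x, 0 ≤ F x := fun x => indicator_nonneg (fun _ _ => by positivity) x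
  have hFle : ∀ x, ENNReal.ofReal (F x) ≤
      ∫⁻ τ in Ioo (0 : ℝ) 1, translateAverage volume (averagingBox n γ κ δ W) G τ x := by
    intro x
    by_cases hx : x ∈ S
    · rw [hF, indicator_of_mem hx]
      have := h.enorm_sub_average_le hv hx
      rw [ENNReal.ofReal_div_of_pos (by positivity), ofReal_norm]
      refine ENNReal.div_le_of_le_mul' (this.trans_eq ?_)
      congr 2
      rw [hC₂]; ring
    · rw [hF, indicator_of_notMem hx]; simp
  have hGint : ∫⁻ x, G x ^ (2 : ℝ) = (eLpNorm (fderiv ℝ v) 2 (volume.restrict S)) ^ (2 : ℝ) := by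
    rw [eLpNorm_eq_lintegral_rpow_enorm_toReal two_ne_zero ENNReal.ofNat_ne_top,
      ← ENNReal.rpow_mul, ← lintegral_indicator hSm]
    simp only [ENNReal.toReal_ofNat, one_div, inv_mul_cancel₀ (two_ne_zero' ℝ), ENNReal.rpow_one]
    refine lintegral_congr fun x => ?_
    by_cases hx : x ∈ S
    · simp [hG, indicator_of_mem hx]
    · simp [hG, indicator_of_notMem hx]
  set k : ℝ := C₂ * C₀ ^ (1 / q) * C₁ ^ (1 / D) * M ^ (n / D) with hk
  have hk0 : 0 < k := by positivity
  have hkey : ∀ N : ℝ, 0 < N → eLpNorm (fderiv ℝ v) 2 (volume.restrict S) ≤ ENNReal.ofReal N →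
      eLpNorm (fun x => v x - m) (ENNReal.ofReal q) (volume.restrict S) ≤
        ENNReal.ofReal k * ENNReal.ofReal N := by
    intro N hN hle
    have hls := lintegral_rpow_le_of_le_lintegral_translateAverage (μ := volume)
      (measurableSet_averagingBox n (κ := κ) (δ := δ) (W := W) hγ0) hD2 hq ha0 hN
      (fun τ hτ => by rw [hD]; exact h.le_volume_averagingBox hτ) hGm hGfin
      (by rw [hGint]; gcongr) hFm hF0 hFle
    have hcalc : ∫⁻ x in S, ‖v x - m‖ₑ ^ q =
        ENNReal.ofReal ((C₂ * δ) ^ q) * ∫⁻ x, ENNReal.ofReal (F x ^ q) := by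
      rw [← lintegral_const_mul' _ _ ENNReal.ofReal_ne_top, ← lintegral_indicator hSm]
      refine lintegral_congr fun x => ?_
      by_cases hx : x ∈ S
      · rw [hF, indicator_of_mem hx, indicator_of_mem hx, ← ENNReal.ofReal_mul (by positivity),
          ← Real.mul_rpow (by positivity) (by positivity),
          mul_div_cancel₀ _ (by positivity : C₂ * δ ≠ 0),
          ENNReal.ofReal_rpow_eq_enorm_rpow _ hq0.le]
      · rw [hF, indicator_of_notMem hx, indicator_of_notMem hx, Real.zero_rpow hq0.ne']; simp
    rw [eLpNorm_eq_lintegral_rpow_enorm_toReal (ENNReal.ofReal_pos.2 hq0).ne'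
      ENNReal.ofReal_ne_top, ENNReal.toReal_ofReal hq0.le, hcalc]
    calc _ ≤ (ENNReal.ofReal ((C₂ * δ) ^ q) *
          ENNReal.ofReal (C₀ * (a ^ (-(q / D)) * N ^ q))) ^ (1 / q) := by gcongr
      _ = ENNReal.ofReal (C₂ * δ * (C₀ ^ (1 / q) * (a ^ (-(1 / D)) * N))) := by
          rw [← ENNReal.ofReal_mul (by positivity), ENNReal.ofReal_rpow_of_pos (by positivity)]
          congr 1
          have hroot : ∀ y : ℝ, 0 ≤ y → (y ^ q) ^ (1 / q) = y := fun y hy => by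
            rw [← Real.rpow_mul hy, mul_one_div_cancel hq0.ne', Real.rpow_one]
          have haq : (a ^ (-(q / D))) ^ (1 / q) = a ^ (-(1 / D)) := by
            rw [← Real.rpow_mul ha0.le]
            congr 1
            field_simp
          rw [Real.mul_rpow (x := (C₂ * δ) ^ q) (by positivity) (by positivity),
            Real.mul_rpow (x := C₀) (by positivity) (by positivity),
            Real.mul_rpow (x := a ^ (-(q / D))) (by positivity) (by positivity),
            hroot _ (by positivity), hroot _ hN.le, haq]
      _ ≤ ENNReal.ofReal (k * N) := by
          refine ENNReal.ofReal_le_ofReal ?_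
          have hvol : δ ≤ C₁ ^ (1 / D) * M ^ (n / D) * a ^ (1 / D) := by
            have h1 := h.rpow_le_mul_volume hM hMW
            rw [← hD] at h1
            calc δ = (δ ^ D) ^ (1 / D) := by
                  rw [← Real.rpow_mul hδ.le, mul_one_div_cancel (by linarith), Real.rpow_one]
              _ ≤ (C₁ * M ^ n * a) ^ (1 / D) := by gcongr
              _ = _ := by
                  rw [Real.mul_rpow (by positivity) ha0.le,
                    Real.mul_rpow hC₁0.le (by positivity), ← Real.rpow_natCast M n,
                    ← Real.rpow_mul hM0.le]
                  congr 3; ring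
          have hvol' : δ * a ^ (-(1 / D)) ≤ C₁ ^ (1 / D) * M ^ (n / D) := by
            rw [Real.rpow_neg ha0.le, ← div_eq_mul_inv, div_le_iff₀ (by positivity)]
            exact hvol
          calc C₂ * δ * (C₀ ^ (1 / q) * (a ^ (-(1 / D)) * N))
              = C₂ * C₀ ^ (1 / q) * (δ * a ^ (-(1 / D))) * N := by ring
            _ ≤ C₂ * C₀ ^ (1 / q) * (C₁ ^ (1 / D) * M ^ (n / D)) * N := by gcongr
            _ = _ := by rw [hk]; ring
      _ = _ := ENNReal.ofReal_mul hk0.le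
  -- The case of a vanishing gradient is obtained by letting `N` decrease to `0`.
  have hk' : ENNReal.ofReal k ≠ 0 := (ENNReal.ofReal_pos.2 hk0).ne'
  rw [mul_comm, ← ENNReal.div_le_iff hk' ENNReal.ofReal_ne_top]
  refine le_of_forall_gt fun b hb => ?_
  obtain ⟨r, hr1, hr2⟩ := ENNReal.lt_iff_exists_nnreal_btwn.1 hb
  have hr0 : 0 < (r : ℝ) := by
    have : (0 : ℝ≥0∞) < r := lt_of_le_of_lt zero_le hr1
    exact_mod_cast this
  have := hkey r hr0 (by rw [ENNReal.ofReal_coe_nnreal]; exact hr1.le)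
  rw [ENNReal.ofReal_coe_nnreal, mul_comm] at this
  exact lt_of_le_of_lt (ENNReal.div_le_of_le_mul this) hr2

/-! ### Mollification of weakly differentiable functions -/

/-- Schur's bound: an integral operator whose kernel has marginals at most `1` is a contraction
on `L²`. -/
lemma lintegral_sq_lintegral_mul_le {α β : Type*} [MeasurableSpace α] [MeasurableSpace β]
    {μ : Measure α} {ν : Measure β} [SFinite μ] [SFinite ν] {K : α → β → ℝ≥0∞}
    (hK : Measurable (Function.uncurry K)) (h1 : ∀ x, ∫⁻ y, K x y ∂ν ≤ 1)
    (h2 : ∀ y, ∫⁻ x, K x y ∂μ ≤ 1) {h : β → ℝ≥0∞} (hh : Measurable h) :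
    ∫⁻ x, (∫⁻ y, K x y * h y ∂ν) ^ (2 : ℝ) ∂μ ≤ ∫⁻ y, h y ^ (2 : ℝ) ∂ν := by
  have hKx : ∀ x, Measurable (K x) := fun x => hK.comp measurable_prodMk_left
  have hpt : ∀ x, (∫⁻ y, K x y * h y ∂ν) ^ (2 : ℝ) ≤ ∫⁻ y, K x y * h y ^ (2 : ℝ) ∂ν := by
    intro x
    have hcs := ENNReal.lintegral_mul_le_Lp_mul_Lq ν Real.HolderConjugate.two_two
      (f := fun y => K x y ^ (1 / 2 : ℝ)) (g := fun y => K x y ^ (1 / 2 : ℝ) * h y)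
      ((hKx x).pow_const _).aemeasurable (((hKx x).pow_const _).mul hh).aemeasurable
    have e1 : ∀ y, K x y ^ (1 / 2 : ℝ) * (K x y ^ (1 / 2 : ℝ) * h y) = K x y * h y := fun y => by
      rw [← mul_assoc, ← ENNReal.rpow_add_of_nonneg _ _ (by norm_num) (by norm_num)]
      norm_num
    have e2 : ∀ y, (K x y ^ (1 / 2 : ℝ)) ^ (2 : ℝ) = K x y := fun y => by
      rw [← ENNReal.rpow_mul]; norm_num
    simp only [Pi.mul_apply, e1, ENNReal.mul_rpow_of_nonneg _ _ (zero_le_two : (0 : ℝ) ≤ 2),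
      e2] at hcs
    calc (∫⁻ y, K x y * h y ∂ν) ^ (2 : ℝ)
        ≤ ((∫⁻ y, K x y ∂ν) ^ (1 / 2 : ℝ) *
            (∫⁻ y, K x y * h y ^ (2 : ℝ) ∂ν) ^ (1 / 2 : ℝ)) ^ (2 : ℝ) := by gcongr
      _ ≤ (1 ^ (1 / 2 : ℝ) * (∫⁻ y, K x y * h y ^ (2 : ℝ) ∂ν) ^ (1 / 2 : ℝ)) ^ (2 : ℝ) := by
          gcongr; exact h1 x
      _ = _ := by
          rw [ENNReal.one_rpow, one_mul, ← ENNReal.rpow_mul]; norm_num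
  calc _ ≤ ∫⁻ x, ∫⁻ y, K x y * h y ^ (2 : ℝ) ∂ν ∂μ := lintegral_mono hpt
    _ = ∫⁻ y, (∫⁻ x, K x y ∂μ) * h y ^ (2 : ℝ) ∂ν := by
        rw [lintegral_lintegral_swap (hK.mul ((hh.comp measurable_snd).pow_const _)).aemeasurable]
        refine lintegral_congr fun y => ?_
        exact lintegral_mul_const _ (hK.comp measurable_prodMk_right)
    _ ≤ ∫⁻ y, 1 * h y ^ (2 : ℝ) ∂ν := by
        gcongr with y; exact h2 y
    _ = _ := by simp

section Mollification

variable {d : ℕ} {Ω : Set (Fin d → ℝ)} {u : (Fin d → ℝ) → ℂ}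
  {g : (Fin d → ℝ) → EuclideanSpace ℂ (Fin d)}

/-- The convolution of `u`, extended by `0` outside `Ω`, with the normalized bump function `ρ`. -/
noncomputable def mollify (ρ : ContDiffBump (0 : Fin d → ℝ)) (Ω : Set (Fin d → ℝ))
    (u : (Fin d → ℝ) → ℂ) : (Fin d → ℝ) → ℂ :=
  ρ.normed volume ⋆[ContinuousLinearMap.lsmul ℝ ℝ, volume] Ω.indicator u

lemma contDiff_mollify (ρ : ContDiffBump (0 : Fin d → ℝ)) (hΩ : MeasurableSet Ω)
    (hu : IntegrableOn u Ω) : ContDiff ℝ 1 (mollify ρ Ω u) :=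
  ρ.hasCompactSupport_normed.contDiff_convolution_left (n := 1) _ ρ.contDiff_normed
    (hu.integrable_indicator hΩ).locallyIntegrable

lemma lintegral_normed_sub_left (ρ : ContDiffBump (0 : Fin d → ℝ)) (x : Fin d → ℝ) :
    ∫⁻ y, ENNReal.ofReal (ρ.normed volume (x - y)) = 1 := by
  rw [lintegral_sub_left_eq_self (fun y => ENNReal.ofReal (ρ.normed volume y)) x,
    ← ofReal_integral_eq_lintegral_ofReal ρ.integrable_normed
      (ae_of_all _ fun x => ρ.nonneg_normed x), ρ.integral_normed, ENNReal.ofReal_one]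

lemma lintegral_normed_sub_right (ρ : ContDiffBump (0 : Fin d → ℝ)) (y : Fin d → ℝ) :
    ∫⁻ x, ENNReal.ofReal (ρ.normed volume (x - y)) = 1 := by
  rw [← lintegral_normed_sub_left ρ y]
  refine lintegral_congr fun x => ?_
  rw [← ρ.normed_neg, neg_sub]

lemma measurable_normed_sub (ρ : ContDiffBump (0 : Fin d → ℝ)) :
    Measurable fun p : (Fin d → ℝ) × (Fin d → ℝ) =>
      ENNReal.ofReal (ρ.normed volume (p.1 - p.2)) :=
  (ENNReal.continuous_ofReal.comp
    (ρ.continuous_normed.comp (continuous_fst.sub continuous_snd))).measurable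

lemma lintegral_enorm_mollify_le (ρ : ContDiffBump (0 : Fin d → ℝ)) (hΩ : MeasurableSet Ω)
    (hu : IntegrableOn u Ω) :
    ∫⁻ x, ‖mollify ρ Ω u x‖ₑ ≤ ∫⁻ y in Ω, ‖u y‖ₑ := by
  have hU : AEMeasurable (fun y => ‖Ω.indicator u y‖ₑ) :=
    (hu.integrable_indicator hΩ).aestronglyMeasurable.enorm
  calc ∫⁻ x, ‖mollify ρ Ω u x‖ₑ
      ≤ ∫⁻ x, ∫⁻ y, ENNReal.ofReal (ρ.normed volume (x - y)) * ‖Ω.indicator u y‖ₑ := by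
        refine lintegral_mono fun x => ?_
        rw [mollify, convolution_lsmul_swap]
        refine (enorm_integral_le_lintegral_enorm _).trans_eq (lintegral_congr fun y => ?_)
        rw [enorm_smul, Real.enorm_of_nonneg (ρ.nonneg_normed _)]
    _ = ∫⁻ y, (∫⁻ x, ENNReal.ofReal (ρ.normed volume (x - y))) * ‖Ω.indicator u y‖ₑ := by
        rw [lintegral_lintegral_swap
          ((measurable_normed_sub ρ).aemeasurable.mul (hU.comp_quasiMeasurePreserving
            Measure.quasiMeasurePreserving_snd))]
        refine lintegral_congr fun y => ?_
        have hm : Measurable fun x => ENNReal.ofReal (ρ.normed volume (x - y)) :=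
          (ENNReal.continuous_ofReal.comp
            (ρ.continuous_normed.comp (continuous_id.sub continuous_const))).measurable
        rw [lintegral_mul_const _ hm]
    _ = ∫⁻ y in Ω, ‖u y‖ₑ := by
        rw [← lintegral_indicator hΩ]
        refine lintegral_congr fun y => ?_
        rw [lintegral_normed_sub_right, one_mul, enorm_indicator_eq_indicator_enorm]

/-- Testing the weak gradient with a translate of the mollifier: at points of distance more than
the mollification radius from the boundary, the derivative of the mollification is the
mollification of the weak gradient. -/
lemma fderiv_mollify_single (ρ : ContDiffBump (0 : Fin d → ℝ)) (hΩ : MeasurableSet Ω)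
    (hu : IntegrableOn u Ω) (hg : IsWeakGradient Ω u g) {x : Fin d → ℝ}
    (hx : Metric.closedBall x ρ.rOut ⊆ Ω) (i : Fin d) :
    fderiv ℝ (mollify ρ Ω u) x (Pi.single i 1) =
      ∫ y in Ω, (ρ.normed volume (x - y) : ℂ) * g y i := by
  have hU : LocallyIntegrable (Ω.indicator u) :=
    (hu.integrable_indicator hΩ).locallyIntegrable
  have hρ1 : ContDiff ℝ 1 (ρ.normed volume) := ρ.contDiff_normed (n := 1)
  have hfd := (ρ.hasCompactSupport_normed (μ := volume)).hasFDerivAt_convolution_left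
    (ContinuousLinearMap.lsmul ℝ ℝ) hρ1 hU x
  have hex := ((ρ.hasCompactSupport_normed (μ := volume)).fderiv ℝ).convolutionExists_left
    ((ContinuousLinearMap.lsmul ℝ ℝ : ℝ →L[ℝ] ℂ →L[ℝ] ℂ).precompL (Fin d → ℝ))
    (hρ1.continuous_fderiv one_ne_zero) hU x
  have hlhs : fderiv ℝ (mollify ρ Ω u) x (Pi.single i 1) =
      ∫ y in Ω, (fderiv ℝ (ρ.normed volume) (x - y) (Pi.single i 1) : ℂ) * u y := by
    rw [mollify, hfd.fderiv, convolution_eq_swap,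
      ContinuousLinearMap.integral_apply hex.integrable_swap, ← integral_indicator hΩ]
    refine integral_congr_ae (ae_of_all _ fun y => ?_)
    by_cases hy : y ∈ Ω
    · simp [ContinuousLinearMap.precompL_apply, hy]
    · simp [hy]
  set φ : (Fin d → ℝ) → ℝ := fun y => ρ.normed volume (x - y) with hφ
  have hφs : tsupport φ ⊆ Metric.closedBall x ρ.rOut := by
    refine closure_minimal (fun y hy => ?_) Metric.isClosed_closedBall
    have hmem : x - y ∈ Function.support (ρ.normed volume) := hy
    rw [ρ.support_normed_eq, mem_ball_zero_iff] at hmem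
    rw [Metric.mem_closedBall, dist_comm, dist_eq_norm]
    exact hmem.le
  have hφd : ∀ y, fderiv ℝ φ y (Pi.single i 1) =
      -fderiv ℝ (ρ.normed volume) (x - y) (Pi.single i 1) := by
    intro y
    have hin := ((hρ1.differentiable one_ne_zero) (x - y)).hasFDerivAt.comp y
      ((hasFDerivAt_id y).const_sub x)
    have hin' : HasFDerivAt φ _ y := hin
    rw [hin'.fderiv]
    simp
  have hw := hg φ (ρ.contDiff_normed.comp (contDiff_const.sub contDiff_id))
    (HasCompactSupport.of_support_subset_isCompact (isCompact_closedBall x ρ.rOut)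
      (subset_closure.trans hφs)) (hφs.trans hx) i
  simp only [hφd, Complex.ofReal_neg, neg_mul, integral_neg, neg_inj] at hw
  rw [hlhs, hw]

lemma norm_le_sum_norm_single {F : Type*} [NormedAddCommGroup F] [NormedSpace ℝ F]
    (L : (Fin d → ℝ) →L[ℝ] F) : ‖L‖ ≤ ∑ i, ‖L (Pi.single i 1)‖ := by
  refine L.opNorm_le_bound (by positivity) fun w => ?_
  calc ‖L w‖ = ‖∑ i, w i • L (Pi.single i 1)‖ := by
        conv_lhs => rw [pi_eq_sum_univ' w]
        simp [map_sum]
    _ ≤ ∑ i, ‖w i • L (Pi.single i 1)‖ := norm_sum_le _ _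
    _ ≤ ∑ i, ‖w‖ * ‖L (Pi.single i 1)‖ := by
        gcongr with i
        rw [norm_smul]
        gcongr
        exact norm_le_pi_norm w i
    _ = _ := by rw [← Finset.mul_sum, mul_comm]

lemma enorm_fderiv_mollify_le (ρ : ContDiffBump (0 : Fin d → ℝ)) (hΩ : MeasurableSet Ω)
    (hu : IntegrableOn u Ω) (hg : IsWeakGradient Ω u g) {x : Fin d → ℝ}
    (hx : Metric.closedBall x ρ.rOut ⊆ Ω) :
    ‖fderiv ℝ (mollify ρ Ω u) x‖ₑ ≤
      d * ∫⁻ y in Ω, ENNReal.ofReal (ρ.normed volume (x - y)) * ‖g y‖ₑ := by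
  have h1 : ‖fderiv ℝ (mollify ρ Ω u) x‖ₑ ≤
      ∑ i, ‖fderiv ℝ (mollify ρ Ω u) x (Pi.single i 1)‖ₑ := by
    rw [← ofReal_norm]
    refine (ENNReal.ofReal_le_ofReal (norm_le_sum_norm_single _)).trans_eq ?_
    rw [ENNReal.ofReal_sum_of_nonneg fun i _ => norm_nonneg _]
    simp only [ofReal_norm]
  calc _ ≤ _ := h1
    _ ≤ ∑ _i : Fin d, ∫⁻ y in Ω, ENNReal.ofReal (ρ.normed volume (x - y)) * ‖g y‖ₑ := by
        gcongr with i
        rw [fderiv_mollify_single ρ hΩ hu hg hx]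
        refine (enorm_integral_le_lintegral_enorm _).trans (lintegral_mono fun y => ?_)
        rw [enorm_mul]
        gcongr
        · rw [← ofReal_norm, Complex.norm_real, Real.norm_of_nonneg (ρ.nonneg_normed _)]
        · rw [← ofReal_norm, ← ofReal_norm]
          exact ENNReal.ofReal_le_ofReal (PiLp.norm_apply_le (g y) i)
    _ = _ := by simp

lemma eLpNorm_fderiv_mollify_le (ρ : ContDiffBump (0 : Fin d → ℝ)) (hΩ : MeasurableSet Ω)
    (hu : IntegrableOn u Ω) (hg : IsWeakGradient Ω u g)
    (hgm : AEStronglyMeasurable g (volume.restrict Ω)) {S : Set (Fin d → ℝ)}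
    (hSm : MeasurableSet S) (hS : ∀ x ∈ S, Metric.closedBall x ρ.rOut ⊆ Ω) :
    eLpNorm (fderiv ℝ (mollify ρ Ω u)) 2 (volume.restrict S) ≤
      d * eLpNorm g 2 (volume.restrict Ω) := by
  have hgen : AEMeasurable (fun y => ‖g y‖ₑ) (volume.restrict Ω) := hgm.enorm
  set h : (Fin d → ℝ) → ℝ≥0∞ := hgen.mk _ with hh
  have hhm : Measurable h := hgen.measurable_mk
  set K : (Fin d → ℝ) → (Fin d → ℝ) → ℝ≥0∞ := fun x y =>
    ENNReal.ofReal (ρ.normed volume (x - y)) with hK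
  have hschur := lintegral_sq_lintegral_mul_le (μ := volume) (ν := volume.restrict Ω) (K := K)
    (measurable_normed_sub ρ)
    (fun x => (setLIntegral_le_lintegral _ _).trans_eq (lintegral_normed_sub_left ρ x))
    (fun y => (lintegral_normed_sub_right ρ y).le) hhm
  have e : ∀ x, ∫⁻ y in Ω, K x y * ‖g y‖ₑ = ∫⁻ y in Ω, K x y * h y := fun x =>
    lintegral_congr_ae (hgen.ae_eq_mk.mono fun y hy => by simp only [hh, ← hy])
  have e' : ∫⁻ y in Ω, h y ^ (2 : ℝ) = ∫⁻ y in Ω, ‖g y‖ₑ ^ (2 : ℝ) :=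
    lintegral_congr_ae (hgen.ae_eq_mk.mono fun y hy => by simp only [hh, ← hy])
  rw [e'] at hschur
  have hKm : Measurable fun x => ∫⁻ y in Ω, K x y * h y :=
    Measurable.lintegral_prod_right' (f := fun p : (Fin d → ℝ) × (Fin d → ℝ) => K p.1 p.2 * h p.2)
      ((measurable_normed_sub ρ).mul (hhm.comp measurable_snd))
  rw [eLpNorm_eq_lintegral_rpow_enorm_toReal two_ne_zero ENNReal.ofNat_ne_top,
    eLpNorm_eq_lintegral_rpow_enorm_toReal two_ne_zero ENNReal.ofNat_ne_top]
  simp only [ENNReal.toReal_ofNat]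
  have hd : ((d : ℝ≥0∞) ^ (2 : ℝ)) ^ (1 / 2 : ℝ) = d := by
    rw [← ENNReal.rpow_mul]; norm_num
  calc (∫⁻ x in S, ‖fderiv ℝ (mollify ρ Ω u) x‖ₑ ^ (2 : ℝ)) ^ (1 / 2 : ℝ)
      ≤ (∫⁻ x in S, (d * ∫⁻ y in Ω, K x y * h y) ^ (2 : ℝ)) ^ (1 / 2 : ℝ) := by
        gcongr ?_ ^ _
        refine setLIntegral_mono' hSm fun x hx => ?_
        gcongr
        rw [← e]
        exact enorm_fderiv_mollify_le ρ hΩ hu hg (hS x hx)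
    _ ≤ (∫⁻ x, (d * ∫⁻ y in Ω, K x y * h y) ^ (2 : ℝ)) ^ (1 / 2 : ℝ) := by
        gcongr ?_ ^ _
        exact setLIntegral_le_lintegral _ _
    _ = d * (∫⁻ x, (∫⁻ y in Ω, K x y * h y) ^ (2 : ℝ)) ^ (1 / 2 : ℝ) := by
        simp only [ENNReal.mul_rpow_of_nonneg _ _ (zero_le_two : (0 : ℝ) ≤ 2)]
        rw [lintegral_const_mul _ (hKm.pow_const _),
          ENNReal.mul_rpow_of_nonneg _ _ (by norm_num), hd]
    _ ≤ _ := by gcongr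

end Mollification

/-! ### Passage to Sobolev functions -/

/-- For a function with mean zero, subtracting a constant decreases the `L^q` norm by a factor of
at most two. -/
lemma eLpNorm_le_two_mul_eLpNorm_sub_const {α : Type*} [MeasurableSpace α] {μ : Measure α}
    [IsFiniteMeasure μ] {u : α → ℂ} (hu : Integrable u μ) (h0 : ∫ x, u x ∂μ = 0) {q : ℝ}
    (hq : 1 ≤ q) (a : ℂ) :
    eLpNorm u (ENNReal.ofReal q) μ ≤ 2 * eLpNorm (fun x => u x - a) (ENNReal.ofReal q) μ := by
  rcases eq_or_ne μ 0 with rfl | hμ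
  · simp
  have hq0 : 0 < q := by linarith
  have hq1 : (1 : ℝ≥0∞) ≤ ENNReal.ofReal q := by
    rw [← ENNReal.ofReal_one]; exact ENNReal.ofReal_le_ofReal hq
  have hμ0 : μ univ ≠ 0 := by simpa using hμ
  have hμt : μ univ ≠ ⊤ := measure_ne_top _ _
  have hsub : Integrable (fun x => u x - a) μ := hu.sub (integrable_const a)
  set X := eLpNorm (fun x => u x - a) (ENNReal.ofReal q) μ with hX
  have h1 : ‖a‖ₑ * μ univ ≤ X * μ univ ^ (1 - 1 / q) := by
    have hint : ∫ x, (u x - a) ∂μ = -(μ.real univ • a) := by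
      rw [integral_sub hu (integrable_const a), h0, integral_const, zero_sub]
    calc ‖a‖ₑ * μ univ = ‖∫ x, (u x - a) ∂μ‖ₑ := by
          rw [hint, enorm_neg, enorm_smul, Real.enorm_of_nonneg measureReal_nonneg,
            ofReal_measureReal hμt, mul_comm]
      _ ≤ ∫⁻ x, ‖u x - a‖ₑ ∂μ := enorm_integral_le_lintegral_enorm _
      _ = eLpNorm (fun x => u x - a) 1 μ := eLpNorm_one_eq_lintegral_enorm.symm
      _ ≤ X * μ univ ^ (1 / (1 : ℝ≥0∞).toReal - 1 / (ENNReal.ofReal q).toReal) :=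
          eLpNorm_le_eLpNorm_mul_rpow_measure_univ hq1 hsub.aestronglyMeasurable
      _ = _ := by rw [ENNReal.toReal_one, div_one, ENNReal.toReal_ofReal hq0.le]
  have h2 : eLpNorm (fun _ : α => a) (ENNReal.ofReal q) μ ≤ X := by
    rw [eLpNorm_const a (ENNReal.ofReal_pos.2 hq0).ne' hμ, ENNReal.toReal_ofReal hq0.le]
    calc ‖a‖ₑ * μ univ ^ (1 / q) = ‖a‖ₑ * μ univ * μ univ ^ (1 / q - 1) := by
          rw [mul_assoc]
          conv_rhs => enter [2, 1]; rw [← ENNReal.rpow_one (μ univ)]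
          rw [← ENNReal.rpow_add _ _ hμ0 hμt]
          congr 2; ring
      _ ≤ X * μ univ ^ (1 - 1 / q) * μ univ ^ (1 / q - 1) := by gcongr
      _ = X := by
          rw [mul_assoc, ← ENNReal.rpow_add _ _ hμ0 hμt]
          simp
  calc eLpNorm u (ENNReal.ofReal q) μ
      = eLpNorm ((fun x => u x - a) + fun _ => a) (ENNReal.ofReal q) μ := by
        congr 1; ext x; simp
    _ ≤ X + eLpNorm (fun _ : α => a) (ENNReal.ofReal q) μ :=
        eLpNorm_add_le hsub.aestronglyMeasurable aestronglyMeasurable_const hq1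
    _ ≤ X + X := by gcongr
    _ = 2 * X := (two_mul X).symm

section OscillatoryDomain

variable {n : ℕ} {c γ M δ : ℝ} {f : (Fin n → ℝ) → ℝ}

/-- The hypotheses on the function whose subgraph is the oscillatory domain. -/
structure IsHolderProfile {n : ℕ} (c γ M δ : ℝ) (f : (Fin n → ℝ) → ℝ) : Prop where
  hc : 0 < c
  hγ : γ ∈ Ioo (0 : ℝ) 1
  hM : 1 ≤ M
  hδ : δ ∈ Ioo (0 : ℝ) 1
  bounds : ∀ x' ∈ baseCube n M δ, f x' ∈ Ico (δ / 4) δ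
  holder : ∀ x' ∈ baseCube n M δ, ∀ y' ∈ baseCube n M δ, |f x' - f y'| ≤ c * ‖x' - y'‖ ^ γ

namespace IsHolderProfile

lemma mem_baseCube_of_Ioo {x' : Fin n → ℝ} {W : ℝ} (hW : W ≤ δ / (2 * M))
    (hx : ∀ i, x' i ∈ Ioo (-W) W) : x' ∈ baseCube n M δ := fun i =>
  ⟨by linarith [(hx i).1], by linarith [(hx i).2]⟩

lemma isHolderSubgraph (h : IsHolderProfile c γ M δ f) {ε : ℝ} (hε : 0 ≤ ε)
    (hεw : ε < δ / (2 * M)) (hεδ : ε + c * ε ^ γ ≤ δ / 16) :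
    IsHolderSubgraph c γ δ (δ / (2 * M) - ε) ε (ε + c * ε ^ γ) f where
  hc := h.hc
  hγ := h.hγ
  hδ := h.hδ
  hW := by linarith
  hWδ := by
    have hM := h.hM
    have h1 : 2 * (δ / (2 * M)) ≤ δ := by
      rw [show 2 * (δ / (2 * M)) = δ / M by field_simp]
      exact div_le_self h.hδ.1.le hM
    linarith
  hs := by
    have := h.hc
    have h2 : 0 ≤ c * ε ^ γ := by positivity
    exact ⟨hε, by linarith⟩
  ht := by
    have := h.hc
    exact ⟨by positivity, hεδ⟩
  bounds x' hx := h.bounds x' (mem_baseCube_of_Ioo (by linarith) hx)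
  holder x' hx y' hy := h.holder x' (mem_baseCube_of_Ioo (by linarith) hx) y'
    (mem_baseCube_of_Ioo (by linarith) hy)

lemma oscillatoryDomain_eq (h : IsHolderProfile c γ M δ f) :
    oscillatoryDomain M δ f = subgraphDomain (δ / (2 * M)) 0 0 f := by
  ext x
  constructor
  · rintro ⟨h1, h2, h3⟩
    exact ⟨h1, h2.1, by simpa using h3⟩
  · rintro ⟨h1, h2, h3⟩
    rw [sub_zero] at h3
    exact ⟨h1, ⟨h2, h3.trans (h.bounds _ (mem_baseCube_of_Ioo le_rfl h1)).2⟩, h3⟩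

lemma measurableSet_oscillatoryDomain (h : IsHolderProfile c γ M δ f) :
    MeasurableSet (oscillatoryDomain M δ f) := by
  have hγ := h.hγ.1
  have hδ := h.hδ.1
  have hM := h.hM
  have := (h.isHolderSubgraph (ε := 0) le_rfl (by positivity)
    (by rw [Real.zero_rpow hγ.ne']; linarith)).isOpen_subgraphDomain.measurableSet
  rw [Real.zero_rpow hγ.ne', mul_zero, add_zero, sub_zero] at this
  rwa [h.oscillatoryDomain_eq]

lemma volume_oscillatoryDomain_ne_top : volume (oscillatoryDomain M δ f) ≠ ⊤ := by
  refine ((measure_mono (t := referenceBox n (δ / (2 * M)) 0 δ) ?_).trans_lt ?_).ne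
  · rintro x ⟨h1, h2, -⟩ i -
    induction i using Fin.lastCases with
    | last => simpa using h2
    | cast i => simpa [Fin.init] using h1 i
  · rw [referenceBox, Real.volume_pi_Ioo]
    exact ENNReal.prod_lt_top fun i _ => ENNReal.ofReal_lt_top

/-- The shrunken domain has distance at least `ε` from the complement of the oscillatory domain. -/
lemma closedBall_subset (h : IsHolderProfile c γ M δ f) {ε : ℝ} (hε : 0 ≤ ε)
    {x : Fin (n + 1) → ℝ}
    (hx : x ∈ subgraphDomain (δ / (2 * M) - ε) ε (ε + c * ε ^ γ) f) :
    Metric.closedBall x ε ⊆ oscillatoryDomain M δ f := by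
  intro y hy
  rw [Metric.mem_closedBall, dist_comm] at hy
  have hcoord : ∀ i, |x i - y i| ≤ ε := fun i => by
    rw [← Real.dist_eq]; exact (dist_le_pi_dist x y i).trans hy
  obtain ⟨h1, h2, h3⟩ := hx
  have hγ := h.hγ.1
  have hc := h.hc
  have hyc : ∀ i : Fin n, Fin.init y i ∈ Ioo (-(δ / (2 * M))) (δ / (2 * M)) := fun i => by
    have := abs_le.1 (hcoord i.castSucc)
    have := h1 i
    simp only [Fin.init]
    constructor <;> linarith [this.1, this.2]
  have hycube := mem_baseCube_of_Ioo le_rfl hyc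
  have hxcube : Fin.init x ∈ baseCube n M δ :=
    mem_baseCube_of_Ioo (W := δ / (2 * M) - ε) (by linarith) h1
  have hdist : ‖(Fin.init x - Fin.init y : Fin n → ℝ)‖ ≤ ε := by
    rw [pi_norm_le_iff_of_nonneg hε]
    intro i
    simpa [Fin.init] using hcoord i.castSucc
  have hholder : f (Fin.init x) - f (Fin.init y) ≤ c * ε ^ γ :=
    (le_abs_self _).trans ((h.holder _ hxcube _ hycube).trans (by gcongr))
  have hl := abs_le.1 (hcoord (Fin.last n))
  have hfy := h.bounds _ hycube
  have hlt : y (Fin.last n) < f (Fin.init y) := by linarith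
  exact ⟨hyc, ⟨by linarith, hlt.trans hfy.2⟩, hlt⟩

lemma eventually_mem_subgraphDomain (h : IsHolderProfile c γ M δ f) {x : Fin (n + 1) → ℝ}
    (hx : x ∈ oscillatoryDomain M δ f) {ε : ℕ → ℝ} (hε : Tendsto ε atTop (𝓝 0)) :
    ∀ᶠ k in atTop, x ∈ subgraphDomain (δ / (2 * M) - ε k) (ε k) (ε k + c * ε k ^ γ) f := by
  obtain ⟨h1, h2, h3⟩ := hx
  have hγ := h.hγ.1
  have hεγ : Tendsto (fun k => ε k + c * ε k ^ γ) atTop (𝓝 0) := by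
    have := hε.add ((hε.rpow_const (p := γ) (Or.inr hγ.le)).const_mul c)
    rwa [Real.zero_rpow hγ.ne', mul_zero, add_zero] at this
  have e1 : ∀ i : Fin n, ∀ᶠ k in atTop,
      x i.castSucc ∈ Ioo (-(δ / (2 * M) - ε k)) (δ / (2 * M) - ε k) := fun i => by
    have hi := h1 i
    simp only [Fin.init] at hi
    have a1 : ∀ᶠ k in atTop, ε k < δ / (2 * M) + x i.castSucc :=
      hε.eventually_lt_const (by linarith [hi.1])
    have a2 : ∀ᶠ k in atTop, ε k < δ / (2 * M) - x i.castSucc :=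
      hε.eventually_lt_const (by linarith [hi.2])
    filter_upwards [a1, a2] with k b1 b2
    exact ⟨by linarith, by linarith⟩
  have e2 : ∀ᶠ k in atTop, ε k < x (Fin.last n) := hε.eventually_lt_const h2.1
  have e3 : ∀ᶠ k in atTop, ε k + c * ε k ^ γ < f (Fin.init x) - x (Fin.last n) :=
    hεγ.eventually_lt_const (by linarith)
  filter_upwards [eventually_all.2 e1, e2, e3] with k b1 b2 b3
  exact ⟨b1, b2, by linarith⟩

end IsHolderProfile

/-- The means over the reference boxes of mollifications of a fixed integrable function are
bounded. -/
lemma enorm_average_mollify_le {u : (Fin (n + 1) → ℝ) → ℂ} {Ω : Set (Fin (n + 1) → ℝ)}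
    (ρ : ContDiffBump (0 : Fin (n + 1) → ℝ)) (hΩ : MeasurableSet Ω) (hu : IntegrableOn u Ω)
    {W s h : ℝ} (hW : 0 ≤ W) {b : ℝ} (hb : b ≤ (2 * W) ^ n * (h - s)) :
    ‖⨍ z in referenceBox n W s h, mollify ρ Ω u z‖ₑ ≤
      (ENNReal.ofReal b)⁻¹ * ∫⁻ y in Ω, ‖u y‖ₑ := by
  rw [average, Measure.restrict_apply_univ]
  refine (enorm_integral_le_lintegral_enorm _).trans ?_
  rw [lintegral_smul_measure, smul_eq_mul, volume_referenceBox n hW]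
  refine mul_le_mul' (ENNReal.inv_le_inv.2 (ENNReal.ofReal_le_ofReal hb)) ?_
  exact (setLIntegral_le_lintegral _ _).trans (lintegral_enorm_mollify_le ρ hΩ hu)

/-- The Poincaré–Sobolev inequality for Sobolev functions, up to an unspecified constant. It
follows from the one for mollifications by Fatou's lemma. -/
theorem exists_eLpNorm_sub_const_le (hn : 1 ≤ n) (hc : 0 < c)
    (hγ : γ ∈ Ioo (0 : ℝ) 1) {D q : ℝ} (hD : D = n / γ + 1) (hq : q = 2 * D / (D - 2)) :
    ∃ K : ℝ, 0 < K ∧ ∀ (M δ : ℝ) (f : (Fin n → ℝ) → ℝ), IsHolderProfile c γ M δ f →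
      ∀ (u : (Fin (n + 1) → ℝ) → ℂ) (g : (Fin (n + 1) → ℝ) → EuclideanSpace ℂ (Fin (n + 1))),
        IsH1WithGradient (oscillatoryDomain M δ f) u g →
        ∃ a : ℂ, eLpNorm (fun x => u x - a) (ENNReal.ofReal q)
            (volume.restrict (oscillatoryDomain M δ f)) ≤
          ENNReal.ofReal (K * M ^ (n / D)) *
            eLpNorm g 2 (volume.restrict (oscillatoryDomain M δ f)) := by
  obtain ⟨K, hK, hsmooth⟩ := exists_eLpNorm_sub_average_le_of_contDiff hn hc hγ hD hq
  refine ⟨K * (n + 1), by positivity, ?_⟩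
  intro M δ f h u g hu
  have hM := h.hM
  have hM0 : 0 < M := by linarith
  have hδ := h.hδ.1
  set Ω := oscillatoryDomain M δ f
  have hΩ : MeasurableSet Ω := h.measurableSet_oscillatoryDomain
  have hΩt : IsFiniteMeasure (volume.restrict Ω) :=
    isFiniteMeasure_restrict.2 IsHolderProfile.volume_oscillatoryDomain_ne_top
  have hui : IntegrableOn u Ω := hu.memLp.integrable one_le_two
  set w : ℝ := δ / (2 * M) with hw
  have hw0 : 0 < w := by positivity
  set ε : ℕ → ℝ := fun k => 1 / ((k : ℝ) + 1) with hεdef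
  have hε0 : ∀ k, 0 < ε k := fun k => by positivity
  have hε : Tendsto ε atTop (𝓝 0) := tendsto_one_div_add_atTop_nhds_zero_nat
  set S : ℕ → Set (Fin (n + 1) → ℝ) := fun k =>
    subgraphDomain (w - ε k) (ε k) (ε k + c * ε k ^ γ) f with hS
  set ρ : ℕ → ContDiffBump (0 : Fin (n + 1) → ℝ) := fun k =>
    ⟨ε k / 2, ε k, half_pos (hε0 k), half_lt_self (hε0 k)⟩ with hρ
  set v : ℕ → (Fin (n + 1) → ℝ) → ℂ := fun k => mollify (ρ k) Ω u with hv
  set a : ℕ → ℂ := fun k => ⨍ z in referenceBox n (w - ε k) (ε k) (δ / 8), v k z with ha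
  have hsmall : ∀ᶠ k in atTop, ε k ≤ w / 2 ∧ ε k + c * ε k ^ γ ≤ δ / 16 := by
    have hεγ : Tendsto (fun k => ε k + c * ε k ^ γ) atTop (𝓝 0) := by
      have := hε.add ((hε.rpow_const (p := γ) (Or.inr hγ.1.le)).const_mul c)
      rwa [Real.zero_rpow hγ.1.ne', mul_zero, add_zero] at this
    exact (hε.eventually_le_const (by positivity)).and (hεγ.eventually_le_const (by positivity))
  have hsub : ∀ᶠ k in atTop, IsHolderSubgraph c γ δ (w - ε k) (ε k) (ε k + c * ε k ^ γ) f := by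
    filter_upwards [hsmall] with k hk
    exact h.isHolderSubgraph (hε0 k).le (by linarith [hk.1]) hk.2
  have hbound : ∀ᶠ k in atTop,
      eLpNorm ((S k).indicator fun x => v k x - a k) (ENNReal.ofReal q) (volume.restrict Ω) ≤
        ENNReal.ofReal (K * (n + 1) * M ^ (n / D)) * eLpNorm g 2 (volume.restrict Ω) := by
    filter_upwards [hsmall, hsub] with k hk hk'
    have hSm : MeasurableSet (S k) := hk'.isOpen_subgraphDomain.measurableSet
    have hball : ∀ x ∈ S k, Metric.closedBall x (ρ k).rOut ⊆ Ω := fun x hx =>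
      h.closedBall_subset (hε0 k).le hx
    have hSΩ : S k ⊆ Ω := fun x hx =>
      hball x hx (Metric.mem_closedBall_self (hε0 k).le)
    rw [eLpNorm_indicator_eq_eLpNorm_restrict hSm, Measure.restrict_restrict hSm,
      inter_eq_left.2 hSΩ]
    have hMW : δ ≤ 4 * M * (w - ε k) := by
      calc δ = 4 * M * (w / 2) := by rw [hw]; field_simp; norm_num
        _ ≤ _ := by
          gcongr
          linarith [hk.1]
    refine (hsmooth M δ _ _ _ f hM hk' hMW (v k) (contDiff_mollify (ρ k) hΩ hui)).trans ?_
    calc _ ≤ ENNReal.ofReal (K * M ^ (n / D)) *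
          (((n + 1 : ℕ) : ℝ≥0∞) * eLpNorm g 2 (volume.restrict Ω)) := by
          gcongr
          exact eLpNorm_fderiv_mollify_le (ρ k) hΩ hui hu.isWeakGradient
            hu.memLp_grad.aestronglyMeasurable hSm hball
      _ = _ := by
          rw [← mul_assoc, ← ENNReal.ofReal_natCast (n + 1), ← ENNReal.ofReal_mul (by positivity)]
          congr 2
          push_cast; ring
  have hI : ∫⁻ y in Ω, ‖u y‖ₑ ≠ ⊤ := hui.2.ne
  set R : ℝ≥0∞ := (ENNReal.ofReal (w ^ n * (δ / 16)))⁻¹ * ∫⁻ y in Ω, ‖u y‖ₑ with hR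
  have hRt : R ≠ ⊤ :=
    ENNReal.mul_ne_top (ENNReal.inv_ne_top.2 (ENNReal.ofReal_pos.2 (by positivity)).ne') hI
  have habd : ∀ᶠ k in atTop, a k ∈ Metric.closedBall (0 : ℂ) R.toReal := by
    filter_upwards [hsmall, hsub] with k hk hk'
    have h2 := enorm_average_mollify_le (ρ k) hΩ hui (W := w - ε k) (s := ε k) (h := δ / 8)
      hk'.hW.le (b := w ^ n * (δ / 16)) (by
        have h3 := hk'.hs.2
        have h4 : w ≤ 2 * (w - ε k) := by linarith [hk.1]
        have h5 : δ / 16 ≤ δ / 8 - ε k := by linarith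
        have h6 : 0 ≤ (2 * (w - ε k)) ^ n := pow_nonneg (by linarith) n
        gcongr)
    rw [mem_closedBall_zero_iff, ← toReal_enorm]
    exact ENNReal.toReal_mono hRt h2
  -- The subtracted constants converge along a subsequence.
  obtain ⟨a₀, -, σ, hσ, hlim⟩ :=
    tendsto_subseq_of_frequently_bounded Metric.isBounded_closedBall habd.frequently
  obtain ⟨k₀, hk₀⟩ := eventually_atTop.1 hsub
  have hσt : Tendsto (fun k => σ (k + k₀)) atTop atTop :=
    hσ.tendsto_atTop.comp (tendsto_add_atTop_nat k₀)
  have hlim' : Tendsto (fun k => a (σ (k + k₀))) atTop (𝓝 a₀) :=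
    hlim.comp (tendsto_add_atTop_nat k₀)
  refine ⟨a₀, ?_⟩
  have hae : ∀ᵐ x ∂(volume : Measure (Fin (n + 1) → ℝ)),
      Tendsto (fun k => v k x) atTop (𝓝 (Ω.indicator u x)) :=
    ContDiffBump.ae_convolution_tendsto_right_of_locallyIntegrable (K := 2) hε
      (Eventually.of_forall fun k => by simp [hρ, mul_div_cancel₀])
      (hui.integrable_indicator hΩ).locallyIntegrable
  refine Lp.eLpNorm_le_of_ae_tendsto (u := atTop)
    (f := fun k => (S (σ (k + k₀))).indicator fun x => v (σ (k + k₀)) x - a (σ (k + k₀)))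
    (hσt.eventually hbound) (fun k => ?_) ?_
  · have hk : k₀ ≤ σ (k + k₀) := (Nat.le_add_left _ _).trans (hσ.id_le _)
    exact (((contDiff_mollify (ρ _) hΩ hui).continuous.sub
      continuous_const).aestronglyMeasurable).indicator
        (hk₀ _ hk).isOpen_subgraphDomain.measurableSet
  · filter_upwards [ae_restrict_of_ae hae, ae_restrict_mem hΩ] with x hx hxΩ
    rw [indicator_of_mem hxΩ] at hx
    refine ((hx.comp hσt).sub hlim').congr' ?_
    filter_upwards [hσt.eventually (h.eventually_mem_subgraphDomain hxΩ hε)] with k hk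
    rw [indicator_of_mem (by exact hk)]
    rfl

end OscillatoryDomain

/-- Here `d = n + 1 ≥ 2`, and `‖x' - y'‖` is the supremum norm on `ℝ^(d-1)`. -/
theorem corollary3p3 (n : ℕ) (hn : 1 ≤ n) (c γ : ℝ) (hc : 0 < c) (hγ : γ ∈ Ioo (0 : ℝ) 1)
    (q : ℝ) (hq : 1 / q = 1 / 2 - 1 / ((n : ℝ) / γ + 1)) :
    ∃ C : ℝ, 0 < C ∧
      ∀ (M δ : ℝ), 1 ≤ M → δ ∈ Ioo (0 : ℝ) 1 →
      ∀ f : (Fin n → ℝ) → ℝ,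
        (∀ x' ∈ baseCube n M δ, f x' ∈ Ico (δ / 4) δ) →
        (∀ x' ∈ baseCube n M δ, ∀ y' ∈ baseCube n M δ, |f x' - f y'| ≤ c * ‖x' - y'‖ ^ γ) →
      ∀ (u : (Fin (n + 1) → ℝ) → ℂ) (g : (Fin (n + 1) → ℝ) → EuclideanSpace ℂ (Fin (n + 1))),
        IsH1WithGradient (oscillatoryDomain M δ f) u g →
        (∫ x in oscillatoryDomain M δ f, u x) = 0 →
        eLpNorm u (ENNReal.ofReal q) (volume.restrict (oscillatoryDomain M δ f)) ^ 2 ≤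
          ENNReal.ofReal (C * M ^ ((n : ℝ) * (1 - 2 / q))) *
            eLpNorm g 2 (volume.restrict (oscillatoryDomain M δ f)) ^ 2 := by
  have hn' : (1 : ℝ) ≤ n := by exact_mod_cast hn
  obtain ⟨D, hD⟩ : ∃ D : ℝ, D = n / γ + 1 := ⟨_, rfl⟩
  have hD2 : 2 < D := by
    have : 1 < n / γ := by rw [lt_div_iff₀ hγ.1]; linarith [hγ.2]
    linarith
  have hD0 : 0 < D - 2 := by linarith
  rw [← hD] at hq
  have hqD : q = 2 * D / (D - 2) := by
    rw [← one_div_one_div q, hq]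
    field_simp
  have hq1 : 1 ≤ q := by
    rw [hqD, le_div_iff₀ hD0]; linarith
  obtain ⟨K, hK, hmain⟩ := exists_eLpNorm_sub_const_le hn hc hγ hD hqD
  refine ⟨4 * K ^ 2, by positivity, ?_⟩
  intro M δ hM hδ f hf hfh u g hu hu0
  have hM0 : 0 < M := by linarith
  obtain ⟨a, ha⟩ := hmain M δ f ⟨hc, hγ, hM, hδ, hf, hfh⟩ u g hu
  have : IsFiniteMeasure (volume.restrict (oscillatoryDomain M δ f)) :=
    isFiniteMeasure_restrict.2 IsHolderProfile.volume_oscillatoryDomain_ne_top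
  have hle := (eLpNorm_le_two_mul_eLpNorm_sub_const (hu.memLp.integrable one_le_two) hu0 hq1
    a).trans (mul_le_mul_right ha 2)
  calc _ ≤ (2 * (ENNReal.ofReal (K * M ^ (n / D)) *
        eLpNorm g 2 (volume.restrict (oscillatoryDomain M δ f)))) ^ 2 := by gcongr
    _ = _ := by
        have h2 : (2 : ℝ≥0∞) * ENNReal.ofReal (K * M ^ (n / D)) =
            ENNReal.ofReal (2 * (K * M ^ (n / D))) := by
          rw [ENNReal.ofReal_mul zero_le_two, ENNReal.ofReal_ofNat]
        rw [← mul_assoc, mul_pow, h2, ← ENNReal.ofReal_pow (by positivity)]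
        congr 2
        have hexp : (n : ℝ) * (1 - 2 / q) = n / D + n / D := by
          rw [show 2 / q = 2 * (1 / q) by ring, hq]; ring
        rw [hexp, Real.rpow_add hM0]
        ring
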